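/- Let $B\in\mathbb{R}$ and let $v:\mathbb{R}\to\mathbb{R}$ satisfy $v_+\in L^2_{\mathrm{loc}}(\mathbb{R})$ and $v_-\in L^2(\mathbb{R})+L^\infty(\mathbb{R})$, where $v_\pm(x)=\max(\pm v(x),0)$. For $p\in\mathbb{R}$ let $h_v(p)$ be the closure in $L^2(\mathbb{R})$ of the operator $-\frac{d^2}{dx^2}+(p+Bx)^2+v(x)$ with domain $C_0^\infty(\mathbb{R})$. Then: (1) $\{h_v(p):p\in\mathbb{R}\}$ is an analytic family of type (B) in the sense of Kato. That is, there are a connected open set $\Omega\subseteq\mathbb{C}$ containing $\mathbb{R}$, a dense subspace $F\subseteq L^2(\mathbb{R})$, and closed sectorial sesquilinear forms $t(\kappa)$, $\kappa\in\Omega$, all with domain $F$, such that $\kappa\mapsto t(\kappa)[\psi,\psi]$ is holomorphic on $\Omega$ for every $\psi\in F$, and for every $p\in\mathbb{R}$ the operator $h_v(p)$ is the one associated with the form $t(p)$. (2) The $p$-dependent part of the form is relatively form-bounded with bound less than one. More precisely, for $p\in\mathbb{R}$ the operators $h_v(p)$ are associated with densely defined closed sectorial forms $q_p$ having a common domain $D$,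 and for all $p_0,p\in\mathbb{R}$ and $\psi\in D$ the function $B(p-p_0)\,x|\psi(x)|^2$ is integrable and $$q_p[\psi]=q_{p_0}[\psi]+d_p[\psi],\qquad d_p[\psi]:=(p^2-p_0^2)\|\psi\|^2+\int_{\mathbb{R}}2Bx(p-p_0)|\psi(x)|^2\,dx .$$ Moreover, for all $p_0,R\in\mathbb{R}$ and every $\varepsilon>0$ there is $\delta\in\mathbb{R}$ such that $$|d_p[\psi]|\le\varepsilon\, q_{p_0}[\psi]+\delta\|\psi\|^2\qquad\text{for all } p\in\mathbb{R}\text{ with }|p-p_0|\le R\text{ and all }\psi\in D .$$ Here a form $t$ with domain $F$ is sectorial if there are $\gamma\in\mathbb{R}$ and $M\ge0$ with $|\operatorname{Im}t[\psi,\psi]|\le M(\operatorname{Re}t[\psi,\psi]-\gamma\|\psi\|^2)$ and $\operatorname{Re}t[\psi,\psi]\ge\gamma\|\psi\|^2$ for all $\psi\in F$. It is closed if $\psi_n\in F$, $\psi_n\to\psi$ in $L^2(\mathbb{R})$ and $t[\psi_n-\psi_m,\psi_n-\psi_m]\to0$ imply $\psi\in F$ and $t[\psi_n-\psi,\psi_n-\psi]\to0$.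 An operator $T$ is associated with $t$ if, for all $u,w\in L^2(\mathbb{R})$, one has $u\in\operatorname{dom}T$ and $Tu=w$ if and only if $u\in F$ and $t[u,\phi]=(w,\phi)$ for all $\phi\in F$. For a form $q$ we write $q[\psi]=q[\psi,\psi]$. -/

import Mathlib

open MeasureTheory Filter Topology
open scoped ContDiff InnerProductSpace

section KatoTypeB

variable {H : Type*} [NormedAddCommGroup H] [InnerProductSpace ℂ H]

/-- A (generally unbounded) sesquilinear form with domain `D ⊆ H`. Following Mathlib's convention it
is antilinear in the first and linear in the second argument, so what is usually written
`t[u, v]`, linear in `u`, reads `t v u` here. -/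
abbrev SesqForm (D : Submodule ℂ H) : Type _ := D →ₗ⋆[ℂ] D →ₗ[ℂ] ℂ

/-- The form `t` is sectorial: its numerical range lies in a sector
`{ζ | |arg (ζ - γ)| ≤ θ}` with vertex `γ ∈ ℝ` and semi-angle `θ < π / 2` (here `M = tan θ`). -/
def SesqForm.IsSectorial {D : Submodule ℂ H} (t : SesqForm D) : Prop :=
  ∃ γ M : ℝ, 0 ≤ M ∧ ∀ u : D, γ * ‖(u : H)‖ ^ 2 ≤ (t u u).re ∧
    |(t u u).im| ≤ M * ((t u u).re - γ * ‖(u : H)‖ ^ 2)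

/-- The form `t` is closed: if `uₙ ∈ D`, `uₙ → x` in `H` and `t[uₙ - uₘ] → 0`, then
`x ∈ D` and `t[uₙ - x] → 0`. -/
def SesqForm.IsClosedForm {D : Submodule ℂ H} (t : SesqForm D) : Prop :=
  ∀ (u : ℕ → D) (x : H), Tendsto (fun n => (u n : H)) atTop (𝓝 x) →
    Tendsto (fun k : ℕ × ℕ => t (u k.1 - u k.2) (u k.1 - u k.2)) atTop (𝓝 0) →
    ∃ hx : x ∈ D, Tendsto (fun n => t (u n - ⟨x, hx⟩) (u n - ⟨x, hx⟩)) atTop (𝓝 0)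

/-- `T` is the operator associated with the form `t` (first representation theorem):
`u ∈ dom T` and `T u = w` if and only if `u ∈ D` and `t[u, v] = (w, v)` for all `v ∈ D`. For a
densely defined closed sectorial form there is exactly one such `T`, it is m-sectorial, and it
determines the form. -/
def SesqForm.IsAssociated {D : Submodule ℂ H} (t : SesqForm D) (T : H →ₗ.[ℂ] H) : Prop :=
  ∀ u w : H, (u, w) ∈ T.graph ↔ ∃ hu : u ∈ D, ∀ v : D, t v ⟨u, hu⟩ = ⟪(v : H), w⟫_ℂ

/-- `t` is a holomorphic family of forms of type (a) on the domain `Ω ⊆ ℂ`, with the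
common (densely defined) form domain `D`. -/
structure IsHolomorphicFamilyTypeA (Ω : Set ℂ) (D : Submodule ℂ H) (t : ℂ → SesqForm D) :
    Prop where
  isOpen : IsOpen Ω
  isConnected : IsConnected Ω
  dense : Dense (D : Set H)
  sectorial : ∀ κ ∈ Ω, (t κ).IsSectorial
  closed : ∀ κ ∈ Ω, (t κ).IsClosedForm
  holomorphic : ∀ u : D, DifferentiableOn ℂ (fun κ => t κ u u) Ω

/-- `T` is a holomorphic family of operators of type (B) on the domain `Ω ⊆ ℂ`: the operators are
those associated with a holomorphic family of forms of type (a). -/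
def IsHolomorphicFamilyTypeB (Ω : Set ℂ) (T : ℂ → H →ₗ.[ℂ] H) : Prop :=
  ∃ (D : Submodule ℂ H) (t : ℂ → SesqForm D), IsHolomorphicFamilyTypeA Ω D t ∧
    ∀ κ ∈ Ω, (t κ).IsAssociated (T κ)

/-- A family of operators `h p` indexed by real `p` is an analytic family of type (B) if it is
the restriction to `ℝ` of a holomorphic family of type (B) on some domain `Ω ⊆ ℂ`
that contains `ℝ`. -/
def IsAnalyticFamilyTypeB (h : ℝ → H →ₗ.[ℂ] H) : Prop :=
  ∃ (Ω : Set ℂ) (T : ℂ → H →ₗ.[ℂ] H), (∀ p : ℝ, (p : ℂ) ∈ Ω) ∧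
    IsHolomorphicFamilyTypeB Ω T ∧ ∀ p : ℝ, T p = h p

end KatoTypeB

/-- The Hilbert space `L²(ℝ)` of complex-valued functions. -/
abbrev L2R : Type := Lp ℂ 2 (volume : Measure ℝ)

/-- Condition on the potential: `v₊ ∈ L²_loc(ℝ)` and `v₋ ∈ L²(ℝ) + L^∞(ℝ)`, where
`v_± = max (± v) 0`. -/
def PotentialCondition (v : ℝ → ℝ) : Prop :=
  (∀ K : Set ℝ, IsCompact K → MemLp (fun x => max (v x) 0) 2 (volume.restrict K)) ∧
  ∃ f g : ℝ → ℝ, MemLp f 2 volume ∧ MemLp g ⊤ volume ∧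
    (fun x => max (-v x) 0) =ᵐ[volume] fun x => f x + g x

/-- The graph of the operator `ψ ↦ -ψ'' + (p + B x)² ψ + v ψ` in `L²(ℝ)` with domain
`C₀^∞(ℝ)`. -/
def fiberMinimalGraph (B : ℝ) (v : ℝ → ℝ) (p : ℝ) : Submodule ℂ (L2R × L2R) where
  carrier := {w | ∃ φ : ℝ → ℂ, ContDiff ℝ ∞ φ ∧ HasCompactSupport φ ∧ w.1 =ᵐ[volume] φ ∧
    w.2 =ᵐ[volume] fun x => -iteratedDeriv 2 φ x + (((p + B * x) ^ 2 + v x : ℝ) : ℂ) * φ x}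
  zero_mem' := by
    refine ⟨fun _ => 0, contDiff_const, HasCompactSupport.zero, ?_, ?_⟩
    · exact Lp.coeFn_zero ℂ 2 volume
    · filter_upwards [Lp.coeFn_zero ℂ 2 (volume : Measure ℝ)] with x hx
      simp [hx]
  add_mem' := by
    rintro a b ⟨φ, hφ, hφc, h1, h2⟩ ⟨χ, hχ, hχc, k1, k2⟩
    refine ⟨φ + χ, hφ.add hχ, hφc.add hχc, ?_, ?_⟩
    · exact (Lp.coeFn_add a.1 b.1).trans (h1.add k1)
    · filter_upwards [Lp.coeFn_add a.2 b.2, h2, k2] with x hx hx2 hx3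
      rw [Prod.snd_add, hx, Pi.add_apply, hx2, hx3, iteratedDeriv_add
        ((hφ.of_le (WithTop.coe_le_coe.2 le_top)).contDiffAt)
        ((hχ.of_le (WithTop.coe_le_coe.2 le_top)).contDiffAt), Pi.add_apply]
      ring
  smul_mem' := by
    rintro c a ⟨φ, hφ, hφc, h1, h2⟩
    refine ⟨c • φ, hφ.const_smul c, hφc.mono (Function.support_const_smul_subset c φ), ?_, ?_⟩
    · exact (Lp.coeFn_smul c a.1).trans (h1.const_smul c)
    · filter_upwards [Lp.coeFn_smul c a.2, h2] with x hx hx2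
      rw [Prod.smul_snd, hx, Pi.smul_apply, hx2, iteratedDeriv_const_smul_field, Pi.smul_apply,
        smul_eq_mul, smul_eq_mul, smul_eq_mul]
      ring

/-- The fiber operator `h_v(p) = -d²/dx² + (p + B x)² + v(x)` in `L²(ℝ)`: the closure of the
differential operator defined on `C₀^∞(ℝ)`, on which it is essentially self-adjoint. -/
noncomputable def fiberOperator (B : ℝ) (v : ℝ → ℝ) (p : ℝ) : L2R →ₗ.[ℂ] L2R :=
  (fiberMinimalGraph B v p).toLinearPMap.closure

/-- The `p`-dependent part of the quadratic form relative to the reference point `p₀`: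
`d_p[ψ] = (p² - p₀²) ‖ψ‖² + (ψ, 2 B x (p - p₀) ψ)`. -/
noncomputable def formPerturbation (B p₀ p : ℝ) (ψ : L2R) : ℝ :=
  (p ^ 2 - p₀ ^ 2) * ‖ψ‖ ^ 2 + ∫ x, 2 * B * x * (p - p₀) * ‖ψ x‖ ^ 2

/-! The expansion `(κ + B x)² + v = (B² x² + v₊) + 2κ B x + κ² - v₋` isolates a nonnegative weight
that does not depend on `κ`. Its natural form domain `formDomain` consists of the `H¹` functions `u`
with `(B² x² + v₊)^{1/2} u ∈ L²`. The other terms are form-small on it. Young's inequality gives `|B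
x| ≤ (θ/2) B² x² + 1/(2θ)` for every `θ > 0`, and the one-dimensional Sobolev inequality bounds `v₋`
by `¼‖u'‖² + C‖u‖²`. So for every complex `κ` the real part of the form, shifted by a multiple of
`‖u‖²`, is comparable to `‖u'‖² + ‖(B² x² + v₊)^{1/2} u‖² + ‖u‖²` (`exists_fiberForm_bounds`).
Sectoriality and closedness on a common domain follow. On the diagonal the form is a quadratic
polynomial in `κ` (`fiberForm_self`), which gives holomorphy on `Ω = ℂ` as well as the formula for
`d_p`; Young's inequality with small `θ` makes the relative bound of `d_p` arbitrarily small.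

It remains to identify the form operator at real `p` with the closure of the operator on test
functions (`operator_fiberForm`). One inclusion is integration by parts together with closedness of
the form graph. The other is a core argument (`graph_le_closure_fiberMinimalGraph`). With `V = (p +
B x)² + v`, a pair `(u, w)` in the form graph satisfies `u'' = V u - w ∈ L²_loc`. Cutting off gives
`(-d²/dx² + V)(χₙ u) = χₙ w - 2 χₙ' u' - χₙ'' u`, which tends to `w` because `u` and `u'` lie in
`L²` globally. Each truncation is then approximated by test functions: `u''` is replaced by a smooth
function that is `L²`-close on a bounded interval and integrated twice. The resulting error in `u`
is uniformly small, so `V ∈ L²_loc` suffices. -/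

/-! ### Weak derivatives on the line. -/

/-- `k` is the weak derivative of `u` on the real line. -/
def HasWeakDeriv (u k : ℝ → ℂ) : Prop :=
  ∀ φ : ℝ → ℂ, ContDiff ℝ ∞ φ → HasCompactSupport φ →
    ∫ x, deriv φ x * u x = -∫ x, φ x * k x

lemma integrable_testFunction_mul {φ f : ℝ → ℂ} (hφ : Continuous φ) (hc : HasCompactSupport φ)
    (hf : LocallyIntegrable f) : Integrable (fun x => φ x * f x) := by
  simpa [smul_eq_mul] using hf.integrable_smul_left_of_hasCompactSupport hφ hc

lemma HasCompactSupport.exists_tsupport_subset_Ioo {φ : ℝ → ℂ} (hc : HasCompactSupport φ) :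
    ∃ L > 0, tsupport φ ⊆ Set.Ioo (-L) L := by
  obtain ⟨r, hr⟩ := hc.isCompact.isBounded.subset_ball 0
  refine ⟨max r 1, by positivity, hr.trans ?_⟩
  rw [Real.ball_eq_Ioo]
  apply Set.Ioo_subset_Ioo <;> simp

/-- Increments of the primitive of `f` are dominated by those of the primitive of `‖f‖`, which is
absolutely continuous. -/
lemma absolutelyContinuousOnInterval_integral {f : ℝ → ℂ} {a b c : ℝ}
    (hf : LocallyIntegrable f) (hc : c ∈ Set.uIcc a b) :
    AbsolutelyContinuousOnInterval (fun x => ∫ t in c..x, f t) a b := by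
  have hi : ∀ x y, IntervalIntegrable f volume x y := fun x y =>
    (hf.integrableOn_isCompact isCompact_uIcc).intervalIntegrable
  have h := (hi a b).norm.absolutelyContinuousOnInterval_intervalIntegral hc
  refine squeeze_zero (fun _ => Finset.sum_nonneg fun _ _ => dist_nonneg) (fun E => ?_) h
  refine Finset.sum_le_sum fun i _ => ?_
  rw [dist_eq_norm, Real.dist_eq, intervalIntegral.integral_interval_sub_left (hi _ _) (hi _ _),
    intervalIntegral.integral_interval_sub_left (hi _ _).norm (hi _ _).norm]
  exact intervalIntegral.norm_integral_le_abs_integral_norm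

lemma continuous_integral_of_locallyIntegrable {f : ℝ → ℂ} (hf : LocallyIntegrable f) (c : ℝ) :
    Continuous (fun x => ∫ t in c..x, f t) :=
  intervalIntegral.continuous_primitive
    (fun _ _ => (hf.integrableOn_isCompact isCompact_uIcc).intervalIntegrable) c

/-- A primitive of a locally integrable function has that function as its weak derivative. -/
lemma hasWeakDeriv_integral {k : ℝ → ℂ} (hk : LocallyIntegrable k) :
    HasWeakDeriv (fun x => ∫ t in (0 : ℝ)..x, k t) k := by
  intro φ hφ hc
  set K : ℝ → ℂ := fun x => ∫ t in (0 : ℝ)..x, k t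
  have hK : Continuous K := continuous_integral_of_locallyIntegrable hk 0
  have hφ1 : ContDiff ℝ 1 φ := hφ.of_le (by exact_mod_cast le_top)
  have hφ' : Continuous (deriv φ) := hφ1.continuous_deriv le_rfl
  have i1 : Integrable (fun x => deriv φ x * K x) :=
    integrable_testFunction_mul hφ' hc.deriv hK.locallyIntegrable
  have i2 : Integrable (fun x => φ x * k x) := integrable_testFunction_mul hφ.continuous hc hk
  have i3 := i1.add i2
  obtain ⟨L, hL, hs⟩ := hc.exists_tsupport_subset_Ioo
  have hsF : Function.support (fun x => deriv φ x * K x + φ x * k x) ⊆ Set.Ioc (-L) L := by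
    intro x hx
    by_contra hx'
    have h1 : x ∉ tsupport φ := fun h => hx' (Set.Ioo_subset_Ioc_self (hs h))
    have h2 : x ∉ tsupport (deriv φ) := fun h => h1 (tsupport_deriv_subset h)
    exact hx (by simp [image_eq_zero_of_notMem_tsupport h1, image_eq_zero_of_notMem_tsupport h2])
  -- The product rule for `φ K` holds only almost everywhere, since `k` is merely locally
  -- integrable. Absolute continuity makes this enough: the difference has derivative zero a.e.,
  -- hence is constant, and comparing its values at `±L`, where `φ` vanishes, gives the claim.
  have hAC : AbsolutelyContinuousOnInterval
      (fun x => φ x • K x - ∫ t in (-L)..x, (deriv φ t * K t + φ t * k t)) (-L) L := by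
    have a1 : AbsolutelyContinuousOnInterval φ (-L) L :=
      hφ1.contDiffOn.absolutelyContinuousOnInterval
    have a2 : AbsolutelyContinuousOnInterval K (-L) L :=
      absolutelyContinuousOnInterval_integral hk (by
        rw [Set.uIcc_of_le (by linarith)]; constructor <;> linarith)
    have a3 : AbsolutelyContinuousOnInterval
        (fun x => ∫ t in (-L)..x, (deriv φ t * K t + φ t * k t)) (-L) L :=
      absolutelyContinuousOnInterval_integral i3.locallyIntegrable (by simp)
    exact (a1.smul a2).sub a3
  obtain ⟨C, hC⟩ := hAC.const_of_ae_hasDerivAt_zero (by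
    filter_upwards [LocallyIntegrable.ae_hasDerivAt_integral hk,
      LocallyIntegrable.ae_hasDerivAt_integral i3.locallyIntegrable]
      with x h1 h2 _
    have h3 : HasDerivAt φ (deriv φ x) x :=
      (hφ1.differentiable (by norm_num) x).hasDerivAt
    have := (h3.mul (h1 0)).sub (h2 (-L))
    convert! this using 1
    simp [K])
  have e1 := hC (-L) (by simp)
  have e2 := hC L (by simp)
  have z1 : φ (-L) = 0 := image_eq_zero_of_notMem_tsupport fun h => by simpa using hs h
  have z2 : φ L = 0 := image_eq_zero_of_notMem_tsupport fun h => by simpa using hs h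
  rw [← e1] at e2
  simp only [z1, z2, zero_smul, intervalIntegral.integral_same, sub_zero, zero_sub,
    neg_eq_zero] at e2
  rw [intervalIntegral.integral_eq_integral_of_support_subset hsF, integral_add i1 i2] at e2
  exact eq_neg_of_add_eq_zero_left e2

/-- The primitive started to the left of the support is zero there, and to the right of the support
it equals the total integral, which vanishes. -/
lemma exists_testFunction_deriv_eq {θ : ℝ → ℂ} (hθ : ContDiff ℝ ∞ θ) (hc : HasCompactSupport θ)
    (h0 : ∫ x, θ x = 0) :
    ∃ Φ : ℝ → ℂ, ContDiff ℝ ∞ Φ ∧ HasCompactSupport Φ ∧ deriv Φ = θ := by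
  obtain ⟨L, hL, hs⟩ := hc.exists_tsupport_subset_Ioo
  have hd : ∀ x, HasDerivAt (fun x => ∫ t in (-L)..x, θ t) (θ x) x := fun x =>
    intervalIntegral.integral_hasDerivAt_right (hθ.continuous.intervalIntegrable _ _)
      (hθ.continuous.stronglyMeasurableAtFilter _ _) hθ.continuous.continuousAt
  have hd' : deriv (fun x => ∫ t in (-L)..x, θ t) = θ := funext fun x => (hd x).deriv
  have hz : ∀ x, x ∉ Set.Ioo (-L) L → θ x = 0 := fun x hx =>
    image_eq_zero_of_notMem_tsupport fun h => hx (hs h)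
  refine ⟨_, contDiff_infty_iff_deriv.2 ⟨fun x => (hd x).differentiableAt, by rwa [hd']⟩,
    HasCompactSupport.intro (K := Set.Icc (-L) L) isCompact_Icc fun x hx => ?_, hd'⟩
  rw [Set.mem_Icc, not_and_or, not_le, not_le] at hx
  rcases hx with hx | hx
  · rw [intervalIntegral.integral_zero_ae]
    refine Eventually.of_forall fun t ht => hz t fun h => ?_
    rw [Set.uIoc_of_ge hx.le] at ht
    exact absurd ht.2 (not_le.2 h.1)
  · rw [intervalIntegral.integral_eq_integral_of_support_subset, h0]
    intro t ht
    by_contra h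
    exact ht (hz t fun h' => h ⟨h'.1, (h'.2.trans hx).le⟩)

lemma HasWeakDeriv.sub {u₁ u₂ k₁ k₂ : ℝ → ℂ} (h₁ : HasWeakDeriv u₁ k₁) (h₂ : HasWeakDeriv u₂ k₂)
    (hu₁ : LocallyIntegrable u₁) (hu₂ : LocallyIntegrable u₂) (hk₁ : LocallyIntegrable k₁)
    (hk₂ : LocallyIntegrable k₂) :
    HasWeakDeriv (fun x => u₁ x - u₂ x) (fun x => k₁ x - k₂ x) := by
  intro φ hφ hc
  have hφ' : Continuous (deriv φ) := (hφ.of_le (by exact_mod_cast le_top :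
    (1 : WithTop ℕ∞) ≤ ∞)).continuous_deriv le_rfl
  simp only [mul_sub]
  rw [integral_sub (integrable_testFunction_mul hφ' hc.deriv hu₁)
      (integrable_testFunction_mul hφ' hc.deriv hu₂),
    integral_sub (integrable_testFunction_mul hφ.continuous hc hk₁)
      (integrable_testFunction_mul hφ.continuous hc hk₂), h₁ φ hφ hc, h₂ φ hφ hc]
  ring

lemma HasWeakDeriv.add {u₁ u₂ k₁ k₂ : ℝ → ℂ} (h₁ : HasWeakDeriv u₁ k₁) (h₂ : HasWeakDeriv u₂ k₂)
    (hu₁ : LocallyIntegrable u₁) (hu₂ : LocallyIntegrable u₂) (hk₁ : LocallyIntegrable k₁)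
    (hk₂ : LocallyIntegrable k₂) :
    HasWeakDeriv (fun x => u₁ x + u₂ x) (fun x => k₁ x + k₂ x) := by
  intro φ hφ hc
  have hφ' : Continuous (deriv φ) := (hφ.of_le (by exact_mod_cast le_top :
    (1 : WithTop ℕ∞) ≤ ∞)).continuous_deriv le_rfl
  simp only [mul_add]
  rw [integral_add (integrable_testFunction_mul hφ' hc.deriv hu₁)
      (integrable_testFunction_mul hφ' hc.deriv hu₂),
    integral_add (integrable_testFunction_mul hφ.continuous hc hk₁)
      (integrable_testFunction_mul hφ.continuous hc hk₂), h₁ φ hφ hc, h₂ φ hφ hc]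
  ring

lemma HasWeakDeriv.const_mul {u k : ℝ → ℂ} (h : HasWeakDeriv u k) (c : ℂ) :
    HasWeakDeriv (fun x => c * u x) (fun x => c * k x) := by
  intro φ hφ hc
  simp only [mul_left_comm _ c]
  rw [integral_const_mul, integral_const_mul, h φ hφ hc, mul_neg]

lemma HasWeakDeriv.congr {u₁ u₂ k₁ k₂ : ℝ → ℂ} (h : HasWeakDeriv u₁ k₁) (hu : u₁ =ᵐ[volume] u₂)
    (hk : k₁ =ᵐ[volume] k₂) : HasWeakDeriv u₂ k₂ := by
  intro φ hφ hc
  rw [← integral_congr_ae (hu.mono fun x hx => congrArg (deriv φ x * ·) hx),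
    ← integral_congr_ae (hk.mono fun x hx => congrArg (φ x * ·) hx), h φ hφ hc]

lemma HasWeakDeriv.ae_unique {u k₁ k₂ : ℝ → ℂ} (h₁ : HasWeakDeriv u k₁) (h₂ : HasWeakDeriv u k₂)
    (hk₁ : LocallyIntegrable k₁) (hk₂ : LocallyIntegrable k₂) : k₁ =ᵐ[volume] k₂ := by
  refine ae_eq_of_integral_contDiff_smul_eq hk₁ hk₂ fun g hg hc => ?_
  have hg' : ContDiff ℝ ∞ (fun x => (g x : ℂ)) := Complex.ofRealCLM.contDiff.comp hg
  have hc' : HasCompactSupport (fun x => (g x : ℂ)) :=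
    hc.comp_left (g := fun x : ℝ => (x : ℂ)) (by simp)
  have := (h₁ _ hg' hc').symm.trans (h₂ _ hg' hc')
  simpa using this

/-- **Du Bois-Reymond lemma**: a function with vanishing weak derivative is constant. -/
lemma HasWeakDeriv.ae_const {h : ℝ → ℂ} (hh : HasWeakDeriv h fun _ => 0)
    (hi : LocallyIntegrable h) : ∃ c : ℂ, h =ᵐ[volume] fun _ => c := by
  let b : ContDiffBump (0 : ℝ) := ⟨1, 2, one_pos, one_lt_two⟩
  set ρ : ℝ → ℂ := fun x => (b.normed volume x : ℂ)
  have hρ : ContDiff ℝ ∞ ρ := Complex.ofRealCLM.contDiff.comp b.contDiff_normed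
  have hρc : HasCompactSupport ρ :=
    b.hasCompactSupport_normed.comp_left (g := fun x : ℝ => (x : ℂ)) (by simp)
  have hρ1 : ∫ x, ρ x = 1 := by
    rw [integral_complex_ofReal, b.integral_normed, Complex.ofReal_one]
  refine ⟨∫ x, ρ x * h x, ae_eq_of_integral_contDiff_smul_eq hi
    (locallyIntegrable_const _) fun g hg hc => ?_⟩
  have hg' : ContDiff ℝ ∞ (fun x => (g x : ℂ)) := Complex.ofRealCLM.contDiff.comp hg
  have hc' : HasCompactSupport (fun x => (g x : ℂ)) :=
    hc.comp_left (g := fun x : ℝ => (x : ℂ)) (by simp)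
  have ig : Integrable (fun x => (g x : ℂ)) := hg'.continuous.integrable_of_hasCompactSupport hc'
  have iρ : Integrable ρ := hρ.continuous.integrable_of_hasCompactSupport hρc
  set m : ℂ := ∫ x, (g x : ℂ)
  -- Subtracting the multiple `m ρ` of a normalized bump makes the test function mean-free, so it is
  -- the derivative of a test function and is annihilated by `h`.
  obtain ⟨Φ, hΦ, hΦc, hΦd⟩ := exists_testFunction_deriv_eq (θ := fun x => (g x : ℂ) - m * ρ x)
    (hg'.sub (contDiff_const.mul hρ)) (hc'.sub (hρc.mul_left (f := fun _ => m))) (by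
      rw [integral_sub ig (iρ.const_mul m), integral_const_mul, hρ1, mul_one, sub_self])
  have h1 := hh Φ hΦ hΦc
  simp only [hΦd, mul_zero, integral_zero, neg_zero, sub_mul, mul_assoc] at h1
  rw [integral_sub (integrable_testFunction_mul hg'.continuous hc' hi)
    ((integrable_testFunction_mul hρ.continuous hρc hi).const_mul m), integral_const_mul,
    sub_eq_zero] at h1
  simp only [Complex.real_smul]
  rw [h1, integral_mul_const]

/-- A function with locally integrable weak derivative is a.e. equal to a primitive of it. -/
lemma HasWeakDeriv.exists_ae_eq_integral {u k : ℝ → ℂ} (h : HasWeakDeriv u k)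
    (hu : LocallyIntegrable u) (hk : LocallyIntegrable k) :
    ∃ c : ℂ, u =ᵐ[volume] fun x => c + ∫ t in (0 : ℝ)..x, k t := by
  have hK := (continuous_integral_of_locallyIntegrable hk 0).locallyIntegrable (μ := volume)
  have h1 := h.sub (hasWeakDeriv_integral hk) hu hK hk hk
  simp only [sub_self] at h1
  obtain ⟨c, hc⟩ := h1.ae_const (hu.sub hK)
  exact ⟨c, hc.mono fun x hx => sub_eq_iff_eq_add.1 hx⟩

lemma hasWeakDeriv_of_contDiff {u : ℝ → ℂ} (hu : ContDiff ℝ 1 u) : HasWeakDeriv u (deriv u) := by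
  intro φ hφ hc
  have hφ1 : ContDiff ℝ 1 φ := hφ.of_le (by exact_mod_cast le_top)
  have hφ' : Continuous (deriv φ) := hφ1.continuous_deriv le_rfl
  have := integral_mul_deriv_eq_deriv_mul_of_integrable (u := φ) (v := u) (u' := deriv φ)
    (v' := deriv u)
    (fun x _ => (hφ1.differentiable (by norm_num) x).hasDerivAt)
    (fun x _ => (hu.differentiable (by norm_num) x).hasDerivAt)
    (integrable_testFunction_mul hφ.continuous hc (hu.continuous_deriv le_rfl).locallyIntegrable)
    (integrable_testFunction_mul hφ' hc.deriv hu.continuous.locallyIntegrable)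
    (integrable_testFunction_mul hφ.continuous hc hu.continuous.locallyIntegrable)
  rw [this, neg_neg]

/-! ### Cauchy–Schwarz and the Sobolev inequality. -/

/-- Cauchy–Schwarz against the constant `1`, obtained by expanding `∫ (c f - I)² ≥ 0`, where `c` is
the total mass and `I = ∫ f`. -/
lemma sq_integral_le_measureReal_mul {α : Type*} [MeasurableSpace α] {μ : Measure α}
    [IsFiniteMeasure μ] {f : α → ℝ} (hf : MemLp f 2 μ) :
    (∫ x, f x ∂μ) ^ 2 ≤ μ.real Set.univ * ∫ x, f x ^ 2 ∂μ := by
  rcases eq_or_ne μ 0 with rfl | hμ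
  · simp
  have hc : 0 < μ.real Set.univ := by
    rw [measureReal_def, ENNReal.toReal_pos_iff]
    exact ⟨Measure.measure_univ_pos.2 hμ, measure_lt_top _ _⟩
  set c := μ.real Set.univ
  set I := ∫ x, f x ∂μ
  have i1 : Integrable f μ := hf.integrable one_le_two
  have i2 : Integrable (fun x => f x ^ 2) μ := hf.integrable_sq
  have h0 : 0 ≤ ∫ x, (c * f x - I) ^ 2 ∂μ := integral_nonneg fun x => sq_nonneg _
  have h1 : ∫ x, (c * f x - I) ^ 2 ∂μ = c ^ 2 * (∫ x, f x ^ 2 ∂μ) - 2 * c * I * I + c * I ^ 2 := by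
    have : ∀ x, (c * f x - I) ^ 2 = c ^ 2 * f x ^ 2 - 2 * c * I * f x + I ^ 2 := fun x => by ring
    simp only [this]
    have i3 : Integrable (fun x => c ^ 2 * f x ^ 2 - 2 * c * I * f x) μ :=
      (i2.const_mul _).sub (i1.const_mul _)
    rw [integral_add i3 (integrable_const _),
      integral_sub (i2.const_mul _) (i1.const_mul _), integral_const_mul, integral_const_mul,
      integral_const, smul_eq_mul]
  have h2 : 0 ≤ c * (c * (∫ x, f x ^ 2 ∂μ) - I ^ 2) := by rw [h1] at h0; linarith
  linarith [nonneg_of_mul_nonneg_right h2 hc]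

lemma L2R.norm_sq_eq (u : L2R) : ‖u‖ ^ 2 = ∫ x, ‖u x‖ ^ 2 := by
  rw [← inner_self_eq_norm_sq (𝕜 := ℂ) u, L2.inner_def]
  have h2 : (fun x => ⟪u x, u x⟫_ℂ) = fun x => ((‖u x‖ ^ 2 : ℝ) : ℂ) := by
    funext x
    rw [inner_self_eq_norm_sq_to_K]
    norm_cast
  rw [h2, integral_complex_ofReal]
  exact Complex.ofReal_re _

lemma L2R.integrable_norm_sq (u : L2R) : Integrable (fun x => ‖u x‖ ^ 2) :=
  (Lp.memLp u).norm.integrable_sq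

lemma L2R.locallyIntegrable (u : L2R) : LocallyIntegrable u :=
  (Lp.memLp u).locallyIntegrable one_le_two

lemma L2R.sq_integral_norm_le (g : L2R) {a b : ℝ} (hab : a ≤ b) :
    (∫ x in a..b, ‖g x‖) ^ 2 ≤ (b - a) * ‖g‖ ^ 2 := by
  rw [intervalIntegral.integral_of_le hab]
  refine (sq_integral_le_measureReal_mul ((Lp.memLp g).norm.restrict _)).trans ?_
  rw [measureReal_restrict_apply_univ, Real.volume_real_Ioc_of_le hab, L2R.norm_sq_eq]
  exact mul_le_mul_of_nonneg_left (setIntegral_le_integral (L2R.integrable_norm_sq g)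
    (Eventually.of_forall fun x => sq_nonneg _)) (sub_nonneg.2 hab)

/-- The one-dimensional Sobolev inequality with a free length scale `η`. -/
lemma HasWeakDeriv.ae_norm_sq_le {u g : L2R} (h : HasWeakDeriv u g) {η : ℝ} (hη : 0 < η) :
    ∀ᵐ x, ‖u x‖ ^ 2 ≤ 2 / η * ‖u‖ ^ 2 + 2 * η * ‖g‖ ^ 2 := by
  have hgi : ∀ x y, IntervalIntegrable g volume x y := fun x y =>
    ((L2R.locallyIntegrable g).integrableOn_isCompact isCompact_uIcc).intervalIntegrable
  obtain ⟨c, hc⟩ := h.exists_ae_eq_integral (L2R.locallyIntegrable u) (L2R.locallyIntegrable g)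
  set f : ℝ → ℂ := fun x => c + ∫ t in (0 : ℝ)..x, g t
  have hfi : Integrable (fun x => ‖f x‖ ^ 2) :=
    (L2R.integrable_norm_sq u).congr (hc.mono fun x hx => by simp only [hx])
  have hfu : ∫ x, ‖f x‖ ^ 2 = ‖u‖ ^ 2 := by
    rw [L2R.norm_sq_eq]
    exact integral_congr_ae (hc.mono fun x hx => by simp only [hx])
  filter_upwards [hc] with x hx
  rw [hx]
  -- The value at `x` is compared with the value at each `y` within distance `η`; averaging over `y`
  -- then turns `‖f y‖²` into at most `‖u‖² / η`.
  have key : ∀ y ∈ Set.Ioc x (x + η), ‖f x‖ ^ 2 ≤ 2 * ‖f y‖ ^ 2 + 2 * (η * ‖g‖ ^ 2) := by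
    intro y hy
    have e : f y - f x = ∫ t in x..y, g t := by
      simp only [f, add_sub_add_left_eq_sub]
      exact intervalIntegral.integral_interval_sub_left (hgi _ _) (hgi _ _)
    have e1 : ‖f y - f x‖ ≤ ∫ t in x..y, ‖g t‖ := by
      rw [e]; exact intervalIntegral.norm_integral_le_integral_norm hy.1.le
    have e2 : ‖f y - f x‖ ^ 2 ≤ η * ‖g‖ ^ 2 :=
      (pow_le_pow_left₀ (norm_nonneg _) e1 2).trans ((L2R.sq_integral_norm_le g hy.1.le).trans
        (mul_le_mul_of_nonneg_right (by linarith [hy.2]) (sq_nonneg _)))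
    have e3 : ‖f x‖ ≤ ‖f y‖ + ‖f y - f x‖ := by
      have := norm_sub_norm_le (f x) (f y)
      rw [norm_sub_rev] at this
      linarith
    nlinarith [sq_nonneg (‖f y‖ - ‖f y - f x‖), norm_nonneg (f x), norm_nonneg (f y),
      norm_nonneg (f y - f x)]
  have hI := setIntegral_mono_on (μ := volume) (s := Set.Ioc x (x + η))
    (f := fun _ => ‖f x‖ ^ 2) (g := fun y => 2 * ‖f y‖ ^ 2 + 2 * (η * ‖g‖ ^ 2))
    (integrableOn_const (by simp))
    ((hfi.const_mul 2).integrableOn.add (integrableOn_const (by simp))) measurableSet_Ioc key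
  rw [integral_add ((hfi.const_mul 2).integrableOn) (integrableOn_const (by simp)),
    setIntegral_const, setIntegral_const, Real.volume_real_Ioc_of_le (by linarith),
    integral_const_mul, smul_eq_mul, smul_eq_mul, add_sub_cancel_left] at hI
  have hII := setIntegral_le_integral (s := Set.Ioc x (x + η)) hfi
    (Eventually.of_forall fun x => sq_nonneg _)
  rw [hfu] at hII
  have h3 : η * ‖f x‖ ^ 2 ≤ η * (2 / η * ‖u‖ ^ 2 + 2 * η * ‖g‖ ^ 2) := by
    have : η * (2 / η * ‖u‖ ^ 2 + 2 * η * ‖g‖ ^ 2) = 2 * ‖u‖ ^ 2 + η * (2 * (η * ‖g‖ ^ 2)) := by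
      field_simp
    rw [this]
    linarith
  exact le_of_mul_le_mul_left h3 hη

/-! ### The potential: measurability, local integrability, form bound for the negative part. -/

namespace PotentialCondition

variable {v : ℝ → ℝ}

lemma aestronglyMeasurable_posPart (hv : PotentialCondition v) :
    AEStronglyMeasurable (fun x => max (v x) 0) volume := by
  have h : AEStronglyMeasurable (fun x => max (v x) 0)
      (volume.restrict (⋃ n : ℕ, Set.Icc (-(n : ℝ)) n)) :=
    aestronglyMeasurable_iUnion_iff.2 fun n =>
      (hv.1 _ isCompact_Icc).aestronglyMeasurable
  have hu : (⋃ n : ℕ, Set.Icc (-(n : ℝ)) n) = Set.univ := by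
    refine Set.eq_univ_of_forall fun x => ?_
    obtain ⟨n, hn⟩ := exists_nat_ge |x|
    exact Set.mem_iUnion.2 ⟨n, abs_le.1 hn⟩
  rwa [hu, Measure.restrict_univ] at h

lemma aestronglyMeasurable_negPart (hv : PotentialCondition v) :
    AEStronglyMeasurable (fun x => max (-v x) 0) volume := by
  obtain ⟨f, g, hf, hg, h⟩ := hv.2
  exact (hf.aestronglyMeasurable.add hg.aestronglyMeasurable).congr h.symm

lemma eq_posPart_sub_negPart (v : ℝ → ℝ) (x : ℝ) : v x = max (v x) 0 - max (-v x) 0 := by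
  rcases le_total 0 (v x) with h | h
  · rw [max_eq_left h, max_eq_right (by linarith), sub_zero]
  · rw [max_eq_right h, max_eq_left (by linarith)]; ring

lemma aestronglyMeasurable (hv : PotentialCondition v) : AEStronglyMeasurable v volume :=
  (hv.aestronglyMeasurable_posPart.sub hv.aestronglyMeasurable_negPart).congr
    (Eventually.of_forall fun x => (eq_posPart_sub_negPart v x).symm)

lemma memLp_restrict (hv : PotentialCondition v) {K : Set ℝ} (hK : IsCompact K) :
    MemLp v 2 (volume.restrict K) := by
  obtain ⟨f, g, hf, hg, h⟩ := hv.2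
  have : IsFiniteMeasure (volume.restrict K) := ⟨by simpa using hK.measure_lt_top⟩
  have h1 : MemLp (fun x => max (-v x) 0) 2 (volume.restrict K) :=
    (memLp_congr_ae (ae_restrict_of_ae h)).2
      ((hf.restrict K).add ((hg.restrict K).mono_exponent le_top))
  exact (memLp_congr_ae (Eventually.of_forall (eq_posPart_sub_negPart v))).2 ((hv.1 K hK).sub h1)

/-- The negative part of the potential is form-bounded with respect to `-d²/dx²` with
relative bound less than one. -/
lemma exists_negPart_bound (hv : PotentialCondition v) :
    ∃ C : ℝ, 0 ≤ C ∧ ∀ u g : L2R, HasWeakDeriv u g →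
      Integrable (fun x => max (-v x) 0 * ‖u x‖ ^ 2) ∧
      ∫ x, max (-v x) 0 * ‖u x‖ ^ 2 ≤ 1 / 4 * ‖g‖ ^ 2 + C * ‖u‖ ^ 2 := by
  obtain ⟨f, b, hf, hb, h⟩ := hv.2
  obtain ⟨M, hM⟩ : ∃ M : ℝ, ∀ᵐ x, ‖b x‖ ≤ M := by
    refine ⟨(eLpNorm b ⊤ volume).toReal, ?_⟩
    filter_upwards [ae_le_eLpNormEssSup (f := b) (μ := volume)] with x hx
    have h2 : ‖b x‖ₑ ≤ eLpNorm b ⊤ volume := by rw [eLpNorm_exponent_top]; exact hx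
    simpa only [toReal_enorm] using ENNReal.toReal_mono hb.eLpNorm_ne_top h2
  set F : ℝ := ∫ x, f x ^ 2
  have hF : 0 ≤ F := integral_nonneg fun x => sq_nonneg _
  -- The Sobolev inequality will contribute `F η ‖g‖²`; this length scale makes `F η ≤ 1/4`, and `F
  -- + 1` avoids division by zero.
  set η : ℝ := 1 / (4 * (F + 1))
  have hη : 0 < η := by positivity
  have hM' : 0 ≤ M := by
    obtain ⟨x, hx⟩ := hM.exists
    exact (norm_nonneg _).trans hx
  refine ⟨F / η + 1 / 2 + M, by positivity, fun u g hug => ?_⟩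
  set S : ℝ := 2 / η * ‖u‖ ^ 2 + 2 * η * ‖g‖ ^ 2
  have hle : ∀ᵐ x, max (-v x) 0 * ‖u x‖ ^ 2 ≤
      1 / 2 * S * f x ^ 2 + (1 / 2 + M) * ‖u x‖ ^ 2 := by
    filter_upwards [h, hM, hug.ae_norm_sq_le hη] with x h1 h2 h3
    rw [h1]
    have h4 : b x ≤ M := (le_abs_self _).trans h2
    -- Since `f ≤ (f² + 1) / 2`, the supremum bound on `‖u x‖²` is needed only against the
    -- integrable function `f²`.
    have h5 : f x * ‖u x‖ ^ 2 ≤ 1 / 2 * (f x ^ 2 * ‖u x‖ ^ 2 + ‖u x‖ ^ 2) := by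
      nlinarith [mul_nonneg (sq_nonneg (f x - 1)) (sq_nonneg ‖u x‖)]
    have h6 : f x ^ 2 * ‖u x‖ ^ 2 ≤ f x ^ 2 * S := mul_le_mul_of_nonneg_left h3 (sq_nonneg _)
    have h7 : b x * ‖u x‖ ^ 2 ≤ M * ‖u x‖ ^ 2 := mul_le_mul_of_nonneg_right h4 (sq_nonneg _)
    linarith
  have hi : Integrable (fun x => 1 / 2 * S * f x ^ 2 + (1 / 2 + M) * ‖u x‖ ^ 2) :=
    (hf.integrable_sq.const_mul _).add ((L2R.integrable_norm_sq u).const_mul _)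
  have hI : Integrable (fun x => max (-v x) 0 * ‖u x‖ ^ 2) := by
    refine hi.mono' (hv.aestronglyMeasurable_negPart.mul
      (L2R.integrable_norm_sq u).aestronglyMeasurable) ?_
    filter_upwards [hle] with x hx
    rwa [Real.norm_of_nonneg (by positivity)]
  refine ⟨hI, (integral_mono_ae hI hi hle).trans ?_⟩
  rw [integral_add (hf.integrable_sq.const_mul _) ((L2R.integrable_norm_sq u).const_mul _),
    integral_const_mul, integral_const_mul, ← L2R.norm_sq_eq]
  have hFη : F * η ≤ 1 / 4 := by
    rw [show F * η = F / (4 * (F + 1)) by simp only [η]; ring, div_le_iff₀ (by positivity)]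
    linarith
  have : 1 / 2 * S * F = F / η * ‖u‖ ^ 2 + F * η * ‖g‖ ^ 2 := by simp only [S]; ring
  rw [this]
  linarith [mul_le_mul_of_nonneg_right hFη (sq_nonneg ‖g‖)]

end PotentialCondition

/-! ### Closedness of weak differentiation and of multiplication in `L²`. -/

lemma exists_forall_integral_mul_eq_inner {φ : ℝ → ℂ} (hφ : Continuous φ)
    (hc : HasCompactSupport φ) : ∃ e : L2R, ∀ u : L2R, ∫ x, φ x * u x = ⟪e, u⟫_ℂ := by
  have hm : MemLp (fun x => starRingEnd ℂ (φ x)) 2 volume :=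
    (Complex.continuous_conj.comp hφ).memLp_of_hasCompactSupport
      (hc.comp_left (g := starRingEnd ℂ) (map_zero _))
  refine ⟨hm.toLp, fun u => ?_⟩
  rw [L2.inner_def]
  refine integral_congr_ae ?_
  filter_upwards [hm.coeFn_toLp] with x hx
  rw [hx, RCLike.inner_apply, Complex.conj_conj, mul_comm]

lemma HasWeakDeriv.of_tendsto {u g : ℕ → L2R} {u₀ g₀ : L2R} (h : ∀ n, HasWeakDeriv (u n) (g n))
    (hu : Tendsto u atTop (𝓝 u₀)) (hg : Tendsto g atTop (𝓝 g₀)) : HasWeakDeriv u₀ g₀ := by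
  intro φ hφ hc
  obtain ⟨e, he⟩ := exists_forall_integral_mul_eq_inner ((hφ.of_le (by exact_mod_cast le_top :
    (1 : WithTop ℕ∞) ≤ ∞)).continuous_deriv le_rfl) hc.deriv
  obtain ⟨e', he'⟩ := exists_forall_integral_mul_eq_inner hφ.continuous hc
  have h1 : Tendsto (fun n => ⟪e, u n⟫_ℂ) atTop (𝓝 ⟪e, u₀⟫_ℂ) := tendsto_const_nhds.inner hu
  have h2 : Tendsto (fun n => ⟪e', g n⟫_ℂ) atTop (𝓝 ⟪e', g₀⟫_ℂ) := tendsto_const_nhds.inner hg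
  have h3 : ∀ n, ⟪e, u n⟫_ℂ = -⟪e', g n⟫_ℂ := fun n => by rw [← he, ← he', h n φ hφ hc]
  simp only [h3] at h1
  rw [he, he']
  exact tendsto_nhds_unique h1 h2.neg

lemma L2R.exists_subseq_tendsto_ae {u : ℕ → L2R} {u₀ : L2R} (hu : Tendsto u atTop (𝓝 u₀)) :
    ∃ ns : ℕ → ℕ, StrictMono ns ∧ ∀ᵐ x, Tendsto (fun n => u (ns n) x) atTop (𝓝 (u₀ x)) :=
  (tendstoInMeasure_of_tendsto_Lp hu).exists_seq_tendsto_ae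

/-- Multiplication by a fixed function is a closed operation in `L²`. -/
lemma L2R.ae_eq_mul_of_tendsto {s : ℝ → ℂ} {u h : ℕ → L2R} {u₀ h₀ : L2R}
    (hs : ∀ n, h n =ᵐ[volume] fun x => s x * u n x)
    (hu : Tendsto u atTop (𝓝 u₀)) (hh : Tendsto h atTop (𝓝 h₀)) :
    h₀ =ᵐ[volume] fun x => s x * u₀ x := by
  obtain ⟨ns, hns, h1⟩ := L2R.exists_subseq_tendsto_ae hu
  obtain ⟨ms, hms, h2⟩ := L2R.exists_subseq_tendsto_ae (hh.comp hns.tendsto_atTop)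
  filter_upwards [h1, h2, ae_all_iff.2 hs] with x h1 h2 h3
  refine tendsto_nhds_unique h2 ?_
  simp only [Function.comp_apply, h3]
  exact (h1.comp hms.tendsto_atTop).const_mul _

/-! ### The form domain and the bound on the linear term. -/

/-- The nonnegative weight `B² x² + v₊(x)`. -/
noncomputable def confiningWeight (B : ℝ) (v : ℝ → ℝ) (x : ℝ) : ℝ := B ^ 2 * x ^ 2 + max (v x) 0

lemma confiningWeight_nonneg (B : ℝ) (v : ℝ → ℝ) (x : ℝ) : 0 ≤ confiningWeight B v x := by
  unfold confiningWeight; positivity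

/-- The common form domain: the `H¹` functions `u` with `(B² x² + v₊)^{1/2} u ∈ L²`. -/
def formDomain (B : ℝ) (v : ℝ → ℝ) : Submodule ℂ L2R where
  carrier := {u | (∃ g : L2R, HasWeakDeriv u g) ∧
    MemLp (fun x => (√(confiningWeight B v x) : ℂ) * u x) 2 volume}
  zero_mem' := by
    refine ⟨⟨0, fun φ _ _ => ?_⟩, ?_⟩
    · rw [integral_eq_zero_of_ae, integral_eq_zero_of_ae, neg_zero] <;>
      · filter_upwards [Lp.coeFn_zero ℂ 2 (volume : Measure ℝ)] with x
        simp
    · refine (memLp_congr_ae ?_).2 (MemLp.zero (p := 2) (ε := ℂ) (μ := (volume : Measure ℝ)))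
      filter_upwards [Lp.coeFn_zero ℂ 2 (volume : Measure ℝ)] with x
      simp
  add_mem' := by
    rintro a b ⟨⟨g, hg⟩, ha⟩ ⟨⟨k, hk⟩, hb⟩
    refine ⟨⟨g + k, (hg.add hk (L2R.locallyIntegrable _) (L2R.locallyIntegrable _)
      (L2R.locallyIntegrable _) (L2R.locallyIntegrable _)).congr (Lp.coeFn_add a b).symm
      (Lp.coeFn_add g k).symm⟩, (memLp_congr_ae ?_).2 (ha.add hb)⟩
    filter_upwards [Lp.coeFn_add a b] with x hx
    rw [hx, Pi.add_apply, mul_add]; rfl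
  smul_mem' := by
    rintro c a ⟨⟨g, hg⟩, ha⟩
    refine ⟨⟨c • g, (hg.const_mul c).congr (Lp.coeFn_smul c a).symm (Lp.coeFn_smul c g).symm⟩,
      (memLp_congr_ae ?_).2 (ha.const_mul c)⟩
    filter_upwards [Lp.coeFn_smul c a] with x hx
    rw [hx, Pi.smul_apply, smul_eq_mul, mul_left_comm]

namespace formDomain

variable {B : ℝ} {v : ℝ → ℝ}

lemma hasWeakDeriv_choose (u : formDomain B v) : HasWeakDeriv (u : L2R) u.2.1.choose :=
  u.2.1.choose_spec

lemma eq_of_hasWeakDeriv {u : ℝ → ℂ} {g k : L2R} (hg : HasWeakDeriv u g)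
    (hk : HasWeakDeriv u k) : g = k :=
  Lp.ext (hg.ae_unique hk (L2R.locallyIntegrable _) (L2R.locallyIntegrable _))

/-- The weak derivative on the form domain. -/
noncomputable def weakDeriv : formDomain B v →ₗ[ℂ] L2R where
  toFun u := u.2.1.choose
  map_add' a b := eq_of_hasWeakDeriv (hasWeakDeriv_choose (a + b))
    (((hasWeakDeriv_choose a).add (hasWeakDeriv_choose b) (L2R.locallyIntegrable _)
      (L2R.locallyIntegrable _) (L2R.locallyIntegrable _) (L2R.locallyIntegrable _)).congr
      (Lp.coeFn_add _ _).symm (Lp.coeFn_add _ _).symm)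
  map_smul' c a := eq_of_hasWeakDeriv (hasWeakDeriv_choose (c • a))
    (((hasWeakDeriv_choose a).const_mul c).congr
      (Lp.coeFn_smul c (a : L2R)).symm (Lp.coeFn_smul c a.2.1.choose).symm)

lemma hasWeakDeriv (u : formDomain B v) : HasWeakDeriv (u : L2R) (weakDeriv u) :=
  hasWeakDeriv_choose u

/-- Multiplication by the square root of the confining weight on the form domain. -/
noncomputable def weighted : formDomain B v →ₗ[ℂ] L2R where
  toFun u := u.2.2.toLp
  map_add' a b := by
    refine Lp.ext ?_
    filter_upwards [(a + b).2.2.coeFn_toLp, a.2.2.coeFn_toLp, b.2.2.coeFn_toLp,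
      Lp.coeFn_add a.2.2.toLp b.2.2.toLp, Lp.coeFn_add (a : L2R) (b : L2R)] with x h1 h2 h3 h4 h5
    rw [h1, h4, Pi.add_apply, h2, h3, Submodule.coe_add, h5, Pi.add_apply, mul_add]
  map_smul' c a := by
    refine Lp.ext ?_
    filter_upwards [(c • a).2.2.coeFn_toLp, a.2.2.coeFn_toLp,
      Lp.coeFn_smul c a.2.2.toLp, Lp.coeFn_smul c (a : L2R)] with x h1 h2 h4 h5
    rw [h1, RingHom.id_apply, h4, Pi.smul_apply, h2, Submodule.coe_smul, h5, Pi.smul_apply,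
      smul_eq_mul, smul_eq_mul, mul_left_comm]

lemma weighted_ae (u : formDomain B v) :
    weighted u =ᵐ[volume] fun x => (√(confiningWeight B v x) : ℂ) * (u : L2R) x :=
  u.2.2.coeFn_toLp

lemma norm_sq_weighted_ae (u : formDomain B v) :
    (fun x => ‖weighted u x‖ ^ 2) =ᵐ[volume]
      fun x => confiningWeight B v x * ‖(u : L2R) x‖ ^ 2 := by
  filter_upwards [weighted_ae u] with x hx
  rw [hx, norm_mul, mul_pow, Complex.norm_real, Real.norm_eq_abs, sq_abs,
    Real.sq_sqrt (confiningWeight_nonneg B v x)]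

lemma integrable_confiningWeight (u : formDomain B v) :
    Integrable (fun x => confiningWeight B v x * ‖(u : L2R) x‖ ^ 2) :=
  (L2R.integrable_norm_sq (weighted u)).congr (norm_sq_weighted_ae u)

lemma norm_sq_weighted (u : formDomain B v) :
    ‖weighted u‖ ^ 2 = ∫ x, confiningWeight B v x * ‖(u : L2R) x‖ ^ 2 := by
  rw [L2R.norm_sq_eq]
  exact integral_congr_ae (norm_sq_weighted_ae u)

/-- Young's inequality: `|B x|` is of lower order than `B² x²`, so the coefficient of the weight can
be made arbitrarily small. All control of the `p`-dependence rests on this. -/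
lemma abs_linear_mul_le (u : formDomain B v) {θ : ℝ} (hθ : 0 < θ) (x : ℝ) :
    |B * x * ‖(u : L2R) x‖ ^ 2| ≤ θ / 2 * (confiningWeight B v x * ‖(u : L2R) x‖ ^ 2)
      + 1 / (2 * θ) * ‖(u : L2R) x‖ ^ 2 := by
  have h0 : 0 ≤ ‖(u : L2R) x‖ ^ 2 := sq_nonneg _
  rw [abs_mul, abs_of_nonneg h0]
  have h1 : |B * x| ≤ θ / 2 * confiningWeight B v x + 1 / (2 * θ) := by
    have h2 : (B * x) ^ 2 ≤ confiningWeight B v x := by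
      unfold confiningWeight; nlinarith [le_max_right (v x) 0]
    have h3 : θ * |B * x| ≤ θ ^ 2 / 2 * (B * x) ^ 2 + 1 / 2 := by
      rw [← sq_abs (B * x)]; nlinarith [sq_nonneg (θ * |B * x| - 1)]
    have h4 : θ * |B * x| ≤ θ * (θ / 2 * confiningWeight B v x + 1 / (2 * θ)) := by
      have : θ * (θ / 2 * confiningWeight B v x + 1 / (2 * θ)) =
          θ ^ 2 / 2 * confiningWeight B v x + 1 / 2 := by field_simp
      rw [this]
      exact h3.trans (by gcongr)
    exact le_of_mul_le_mul_left h4 hθ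
  calc _ ≤ (θ / 2 * confiningWeight B v x + 1 / (2 * θ)) * ‖(u : L2R) x‖ ^ 2 :=
        mul_le_mul_of_nonneg_right h1 h0
    _ = _ := by ring

lemma integrable_linear (u : formDomain B v) :
    Integrable (fun x => B * x * ‖(u : L2R) x‖ ^ 2) := by
  refine Integrable.mono' (((integrable_confiningWeight u).const_mul (1 / 2)).add
    ((L2R.integrable_norm_sq (u : L2R)).const_mul (1 / (2 * 1))))
    ((by fun_prop : AEStronglyMeasurable (fun x : ℝ => B * x) volume).mul
      (L2R.integrable_norm_sq _).aestronglyMeasurable)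
    (Eventually.of_forall fun x => abs_linear_mul_le u one_pos x)

lemma abs_integral_linear_le (u : formDomain B v) {θ : ℝ} (hθ : 0 < θ) :
    |∫ x, B * x * ‖(u : L2R) x‖ ^ 2| ≤
      θ / 2 * ‖weighted u‖ ^ 2 + 1 / (2 * θ) * ‖(u : L2R)‖ ^ 2 := by
  have h1 := (integrable_confiningWeight u).const_mul (θ / 2)
  have h2 := (L2R.integrable_norm_sq (u : L2R)).const_mul (1 / (2 * θ))
  refine (norm_integral_le_of_norm_le (f := fun x => B * x * ‖(u : L2R) x‖ ^ 2) (h1.fun_add h2)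
    (Eventually.of_forall fun x => abs_linear_mul_le u hθ x)).trans_eq ?_
  rw [integral_add h1 h2, integral_const_mul, integral_const_mul, norm_sq_weighted,
    L2R.norm_sq_eq (u : L2R)]

end formDomain

/-! ### The form for complex `κ`: sectorial, closed, holomorphic. -/

/-- The complexified potential `(κ + B x)² + v(x)`. -/
noncomputable def fiberPotential (B : ℝ) (v : ℝ → ℝ) (κ : ℂ) (x : ℝ) : ℂ :=
  (κ + B * x) ^ 2 + v x

lemma fiberPotential_eq (B : ℝ) (v : ℝ → ℝ) (κ : ℂ) (x : ℝ) : fiberPotential B v κ x =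
    (confiningWeight B v x : ℂ) + 2 * κ * (B * x : ℝ) + κ ^ 2 - (max (-v x) 0 : ℝ) := by
  have h : (v x : ℂ) = ((max (v x) 0 - max (-v x) 0 : ℝ) : ℂ) :=
    congrArg _ (PotentialCondition.eq_posPart_sub_negPart v x)
  rw [fiberPotential, confiningWeight, h]
  push_cast
  ring

lemma PotentialCondition.aestronglyMeasurable_fiberPotential {v : ℝ → ℝ}
    (hv : PotentialCondition v) (B : ℝ) (κ : ℂ) :
    AEStronglyMeasurable (fiberPotential B v κ) volume :=
  (by fun_prop : AEStronglyMeasurable (fun x : ℝ => (κ + B * x) ^ 2) volume).add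
    (Complex.continuous_ofReal.comp_aestronglyMeasurable hv.aestronglyMeasurable)

namespace formDomain

variable {B : ℝ} {v : ℝ → ℝ}

lemma integrable_fiberPotential_norm (hv : PotentialCondition v) (κ : ℂ) (u : formDomain B v) :
    Integrable (fun x => fiberPotential B v κ x * (‖(u : L2R) x‖ ^ 2 : ℝ)) := by
  obtain ⟨_, _, hC⟩ := hv.exists_negPart_bound
  have h := (((integrable_confiningWeight u).ofReal (𝕜 := ℂ)).add
    (((integrable_linear u).ofReal (𝕜 := ℂ)).const_mul (2 * κ))).add
    (((L2R.integrable_norm_sq (u : L2R)).ofReal (𝕜 := ℂ)).const_mul (κ ^ 2)) |>.sub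
    ((hC u _ (hasWeakDeriv u)).1.ofReal (𝕜 := ℂ))
  refine h.congr (Eventually.of_forall fun x => ?_)
  simp only [Pi.add_apply, Pi.sub_apply, fiberPotential_eq]
  push_cast
  simp only [Complex.coe_algebraMap]
  ring

lemma integrable_fiberPotential (hv : PotentialCondition v) (κ : ℂ) (w u : formDomain B v) :
    Integrable (fun x => starRingEnd ℂ ((w : L2R) x) * (fiberPotential B v κ x * (u : L2R) x)) := by
  refine Integrable.mono' ((integrable_fiberPotential_norm hv κ w).norm.add
    (integrable_fiberPotential_norm hv κ u).norm)
    ((Complex.continuous_conj.comp_aestronglyMeasurable (Lp.aestronglyMeasurable _)).mul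
      ((hv.aestronglyMeasurable_fiberPotential B κ).mul (Lp.aestronglyMeasurable _)))
    (Eventually.of_forall fun x => ?_)
  simp only [norm_mul, RCLike.norm_conj, Pi.add_apply, Complex.norm_real, Real.norm_eq_abs,
    abs_of_nonneg (sq_nonneg ‖(w : L2R) x‖), abs_of_nonneg (sq_nonneg ‖(u : L2R) x‖)]
  have h1 : ‖(w : L2R) x‖ * ‖(u : L2R) x‖ ≤ ‖(w : L2R) x‖ ^ 2 + ‖(u : L2R) x‖ ^ 2 := by
    nlinarith [sq_nonneg (‖(w : L2R) x‖ - ‖(u : L2R) x‖), sq_nonneg (‖(w : L2R) x‖),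
      sq_nonneg (‖(u : L2R) x‖)]
  nlinarith [mul_le_mul_of_nonneg_left h1 (norm_nonneg (fiberPotential B v κ x))]

end formDomain

/-- The sesquilinear form of `-d²/dx² + (κ + B x)² + v` for complex `κ`. -/
noncomputable def fiberForm (B : ℝ) {v : ℝ → ℝ} (hv : PotentialCondition v) (κ : ℂ) :
    SesqForm (formDomain B v) :=
  LinearMap.mk₂'ₛₗ (starRingEnd ℂ) (RingHom.id ℂ)
    (fun w u => ⟪formDomain.weakDeriv w, formDomain.weakDeriv u⟫_ℂ +
      ∫ x, starRingEnd ℂ ((w : L2R) x) * (fiberPotential B v κ x * (u : L2R) x))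
    (fun w w' u => by
      rw [map_add, inner_add_left, add_add_add_comm,
        ← integral_add (formDomain.integrable_fiberPotential hv κ w u)
          (formDomain.integrable_fiberPotential hv κ w' u)]
      congr 1
      refine integral_congr_ae ?_
      filter_upwards [Lp.coeFn_add (w : L2R) (w' : L2R)] with x hx
      rw [Submodule.coe_add, hx, Pi.add_apply, map_add, add_mul])
    (fun c w u => by
      rw [map_smul, inner_smul_left, smul_eq_mul, mul_add, ← integral_const_mul]
      congr 1
      refine integral_congr_ae ?_
      filter_upwards [Lp.coeFn_smul c (w : L2R)] with x hx
      rw [Submodule.coe_smul, hx, Pi.smul_apply, smul_eq_mul, map_mul, mul_assoc])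
    (fun w u u' => by
      rw [map_add, inner_add_right, add_add_add_comm,
        ← integral_add (formDomain.integrable_fiberPotential hv κ w u)
          (formDomain.integrable_fiberPotential hv κ w u')]
      congr 1
      refine integral_congr_ae ?_
      filter_upwards [Lp.coeFn_add (u : L2R) (u' : L2R)] with x hx
      rw [Submodule.coe_add, hx, Pi.add_apply]
      ring)
    (fun c w u => by
      rw [map_smul, inner_smul_right, RingHom.id_apply, smul_eq_mul, mul_add,
        ← integral_const_mul]
      congr 1
      refine integral_congr_ae ?_
      filter_upwards [Lp.coeFn_smul c (u : L2R)] with x hx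
      rw [Submodule.coe_smul, hx, Pi.smul_apply, smul_eq_mul]
      ring)

lemma fiberForm_apply (B : ℝ) {v : ℝ → ℝ} (hv : PotentialCondition v) (κ : ℂ)
    (w u : formDomain B v) : fiberForm B hv κ w u =
      ⟪formDomain.weakDeriv w, formDomain.weakDeriv u⟫_ℂ +
        ∫ x, starRingEnd ℂ ((w : L2R) x) * (fiberPotential B v κ x * (u : L2R) x) := rfl

/-- The diagonal is a quadratic polynomial in `κ` with real coefficients. Holomorphy and the formula
for `d_p` are read off from it. -/
lemma fiberForm_self (B : ℝ) {v : ℝ → ℝ} (hv : PotentialCondition v) (κ : ℂ)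
    (u : formDomain B v) : fiberForm B hv κ u u =
      ((‖formDomain.weakDeriv u‖ ^ 2 + ‖formDomain.weighted u‖ ^ 2
        - ∫ x, max (-v x) 0 * ‖(u : L2R) x‖ ^ 2 : ℝ) : ℂ)
        + 2 * κ * (∫ x, B * x * ‖(u : L2R) x‖ ^ 2 : ℝ) + κ ^ 2 * (‖(u : L2R)‖ ^ 2 : ℝ) := by
  obtain ⟨_, _, hC⟩ := hv.exists_negPart_bound
  have i1 : Integrable (fun x => ((confiningWeight B v x * ‖(u : L2R) x‖ ^ 2 : ℝ) : ℂ)) :=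
    (formDomain.integrable_confiningWeight u).ofReal
  have i2 : Integrable (fun x => 2 * κ * ((B * x * ‖(u : L2R) x‖ ^ 2 : ℝ) : ℂ)) :=
    (formDomain.integrable_linear u).ofReal.const_mul (2 * κ)
  have i3 : Integrable (fun x => κ ^ 2 * ((‖(u : L2R) x‖ ^ 2 : ℝ) : ℂ)) :=
    (L2R.integrable_norm_sq (u : L2R)).ofReal.const_mul (κ ^ 2)
  have i4 : Integrable (fun x => ((max (-v x) 0 * ‖(u : L2R) x‖ ^ 2 : ℝ) : ℂ)) :=
    (hC u _ (formDomain.hasWeakDeriv u)).1.ofReal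
  have h1 : ∫ x, starRingEnd ℂ ((u : L2R) x) * (fiberPotential B v κ x * (u : L2R) x) =
      ∫ x, (((confiningWeight B v x * ‖(u : L2R) x‖ ^ 2 : ℝ) : ℂ)
        + 2 * κ * ((B * x * ‖(u : L2R) x‖ ^ 2 : ℝ) : ℂ)
        + κ ^ 2 * ((‖(u : L2R) x‖ ^ 2 : ℝ) : ℂ)
        - ((max (-v x) 0 * ‖(u : L2R) x‖ ^ 2 : ℝ) : ℂ)) := by
    refine integral_congr_ae (Eventually.of_forall fun x => ?_)
    simp only
    rw [mul_left_comm, ← Complex.normSq_eq_conj_mul_self, Complex.normSq_eq_norm_sq,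
      fiberPotential_eq]
    push_cast
    ring
  rw [fiberForm_apply, h1, inner_self_eq_norm_sq_to_K, integral_sub ((i1.fun_add i2).fun_add i3) i4,
    integral_add (i1.fun_add i2) i3, integral_add i1 i2, integral_const_mul, integral_const_mul,
    integral_complex_ofReal, integral_complex_ofReal, integral_complex_ofReal,
    integral_complex_ofReal, ← formDomain.norm_sq_weighted, ← L2R.norm_sq_eq]
  push_cast
  simp only [Complex.coe_algebraMap]
  ring

/-- The form norm `‖u'‖² + ‖(B² x² + v₊)^{1/2} u‖²` controls, and is controlled by, the form. -/
lemma exists_fiberForm_bounds (B : ℝ) {v : ℝ → ℝ} (hv : PotentialCondition v) (κ : ℂ) :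
    ∃ K : ℝ, 0 ≤ K ∧ ∀ u : formDomain B v,
      ‖formDomain.weakDeriv u‖ ^ 2 + ‖formDomain.weighted u‖ ^ 2 ≤
        2 * ((fiberForm B hv κ u u).re + K * ‖(u : L2R)‖ ^ 2) ∧
      ‖fiberForm B hv κ u u‖ ≤ K * (‖formDomain.weakDeriv u‖ ^ 2 + ‖formDomain.weighted u‖ ^ 2
        + ‖(u : L2R)‖ ^ 2) := by
  obtain ⟨C, hC0, hC⟩ := hv.exists_negPart_bound
  set r := ‖κ‖
  have hr : 0 ≤ r := norm_nonneg κ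
  refine ⟨3 + C + 2 * r * (r + 1) + r ^ 2, by positivity, fun u => ?_⟩
  have hV := (hC u _ (formDomain.hasWeakDeriv u)).2
  have hV0 : 0 ≤ ∫ x, max (-v x) 0 * ‖(u : L2R) x‖ ^ 2 :=
    integral_nonneg fun x => mul_nonneg (le_max_right _ _) (sq_nonneg _)
  -- With this `θ` the linear term costs at most half of the weighted norm. The negative part costs
  -- a quarter of `‖u'‖²`, so at least half of the form norm survives; hence the factor `2` in the
  -- lower bound.
  have hX := formDomain.abs_integral_linear_le u (θ := 1 / (2 * (r + 1))) (by positivity)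
  have hself := fiberForm_self B hv κ u
  set V := ∫ x, max (-v x) 0 * ‖(u : L2R) x‖ ^ 2
  set X := ∫ x, B * x * ‖(u : L2R) x‖ ^ 2
  set t := fiberForm B hv κ u u
  set n := ‖(u : L2R)‖ ^ 2
  set d := ‖formDomain.weakDeriv u‖ ^ 2
  set s := ‖formDomain.weighted u‖ ^ 2
  have hn : 0 ≤ n := sq_nonneg _
  have hd : 0 ≤ d := sq_nonneg _
  have hs : 0 ≤ s := sq_nonneg _
  have hX' : 2 * r * |X| ≤ 1 / 2 * s + 2 * r * (r + 1) * n := by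
    have e : 1 / (2 * (r + 1)) / 2 * s + 1 / (2 * (1 / (2 * (r + 1)))) * n =
        1 / (4 * (r + 1)) * s + (r + 1) * n := by
      field_simp; ring
    rw [e] at hX
    have h2 : 2 * r * (1 / (4 * (r + 1))) ≤ 1 / 2 := by
      rw [mul_one_div, div_le_iff₀ (by positivity)]; linarith
    calc 2 * r * |X| ≤ 2 * r * (1 / (4 * (r + 1)) * s + (r + 1) * n) :=
          mul_le_mul_of_nonneg_left hX (by positivity)
      _ = 2 * r * (1 / (4 * (r + 1))) * s + 2 * r * (r + 1) * n := by ring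
      _ ≤ _ := by gcongr
  have hXn : ‖2 * κ * (X : ℂ)‖ = 2 * r * |X| := by
    rw [norm_mul, norm_mul, Complex.norm_real, Complex.norm_ofNat]; rfl
  have hκn : ‖κ ^ 2 * (n : ℂ)‖ = r ^ 2 * n := by
    rw [norm_mul, norm_pow, Complex.norm_real, Real.norm_of_nonneg hn]
  have hre : t.re = d + s - V + (2 * κ * (X : ℂ)).re + (κ ^ 2 * (n : ℂ)).re := by
    rw [hself, Complex.add_re, Complex.add_re, Complex.ofReal_re]
  constructor
  · have h1 := (abs_le.1 ((Complex.abs_re_le_norm (2 * κ * (X : ℂ))).trans_eq hXn)).1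
    have h2 := (abs_le.1 ((Complex.abs_re_le_norm (κ ^ 2 * (n : ℂ))).trans_eq hκn)).1
    rw [hre]
    nlinarith
  · have h1 : ‖((d + s - V : ℝ) : ℂ)‖ ≤ d + s + V := by
      rw [Complex.norm_real, Real.norm_eq_abs, abs_le]; constructor <;> linarith
    have h2 : ‖t‖ ≤ (d + s + V) + 2 * r * |X| + r ^ 2 * n := by
      rw [hself, ← hXn, ← hκn]
      exact (norm_add₃_le).trans (by gcongr)
    have h3 : 0 ≤ (C + 2 * r * (r + 1) + r ^ 2) * (d + s) := by positivity
    nlinarith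

lemma fiberForm_isSectorial (B : ℝ) {v : ℝ → ℝ} (hv : PotentialCondition v) (κ : ℂ) :
    (fiberForm B hv κ).IsSectorial := by
  obtain ⟨K, hK, h⟩ := exists_fiberForm_bounds B hv κ
  -- The lower bound gives `energy ≤ 2 (Re t + (K + 1/2) ‖u‖²)`, where the energy is the form norm
  -- plus `‖u‖²`; multiplying by `K` bounds `|Im t|`.
  refine ⟨-(K + 1 / 2), 2 * K, by positivity, fun u => ?_⟩
  obtain ⟨h1, h2⟩ := h u
  have h0 : 0 ≤ ‖formDomain.weakDeriv u‖ ^ 2 + ‖formDomain.weighted u‖ ^ 2 := by positivity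
  have hn : 0 ≤ ‖(u : L2R)‖ ^ 2 := sq_nonneg _
  constructor
  · linarith
  · refine (Complex.abs_im_le_norm _).trans (h2.trans ?_)
    rw [mul_comm 2 K, mul_assoc]
    exact mul_le_mul_of_nonneg_left (by linarith) hK

lemma cauchySeq_of_tendsto_norm_sub_sq {E : Type*} [NormedAddCommGroup E] {u : ℕ → E}
    (h : Tendsto (fun k : ℕ × ℕ => ‖u k.1 - u k.2‖ ^ 2) atTop (𝓝 0)) : CauchySeq u := by
  rw [cauchySeq_iff_tendsto_dist_atTop_0]
  have := h.sqrt
  simpa [Real.sqrt_sq, dist_eq_norm] using this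

/-- By the two-sided bounds, a form-Cauchy sequence converging in `L²` has Cauchy derivatives and
Cauchy weighted functions. Differentiation and multiplication are closed, so the limits are those of
`x`, and the upper bound returns form convergence. -/
lemma fiberForm_isClosedForm (B : ℝ) {v : ℝ → ℝ} (hv : PotentialCondition v) (κ : ℂ) :
    (fiberForm B hv κ).IsClosedForm := by
  intro u x hux ht
  obtain ⟨K, hK, h⟩ := exists_fiberForm_bounds B hv κ
  have hu2 : Tendsto (fun k : ℕ × ℕ => ‖((u k.1 - u k.2 : formDomain B v) : L2R)‖ ^ 2) atTop
      (𝓝 0) := by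
    have := (cauchySeq_iff_tendsto_dist_atTop_0.1 hux.cauchySeq).pow 2
    simpa [dist_eq_norm] using this
  have hre := (Complex.continuous_re.tendsto 0).comp ht
  have hN : Tendsto (fun k : ℕ × ℕ => 2 * ((fiberForm B hv κ (u k.1 - u k.2) (u k.1 - u k.2)).re
      + K * ‖((u k.1 - u k.2 : formDomain B v) : L2R)‖ ^ 2)) atTop (𝓝 0) := by
    simpa using (hre.add (hu2.const_mul K)).const_mul 2
  have hd : CauchySeq fun n => formDomain.weakDeriv (u n) := by
    refine cauchySeq_of_tendsto_norm_sub_sq (squeeze_zero (fun _ => sq_nonneg _) (fun k => ?_) hN)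
    rw [← map_sub]
    exact le_trans (le_add_of_nonneg_right (sq_nonneg _)) (h (u k.1 - u k.2)).1
  have hs : CauchySeq fun n => formDomain.weighted (u n) := by
    refine cauchySeq_of_tendsto_norm_sub_sq (squeeze_zero (fun _ => sq_nonneg _) (fun k => ?_) hN)
    rw [← map_sub]
    exact le_trans (le_add_of_nonneg_left (sq_nonneg _)) (h (u k.1 - u k.2)).1
  obtain ⟨g, hg⟩ := cauchySeq_tendsto_of_complete hd
  obtain ⟨z, hz⟩ := cauchySeq_tendsto_of_complete hs
  have hxg : HasWeakDeriv x g :=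
    HasWeakDeriv.of_tendsto (fun n => formDomain.hasWeakDeriv (u n)) hux hg
  have hxz := L2R.ae_eq_mul_of_tendsto (fun n => formDomain.weighted_ae (u n)) hux hz
  have hx : x ∈ formDomain B v := ⟨⟨g, hxg⟩, (memLp_congr_ae hxz).1 (Lp.memLp z)⟩
  refine ⟨hx, ?_⟩
  have e1 : formDomain.weakDeriv (⟨x, hx⟩ : formDomain B v) = g :=
    formDomain.eq_of_hasWeakDeriv (formDomain.hasWeakDeriv _) hxg
  have e2 : formDomain.weighted (⟨x, hx⟩ : formDomain B v) = z :=
    Lp.ext ((formDomain.weighted_ae (⟨x, hx⟩ : formDomain B v)).trans hxz.symm)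
  refine squeeze_zero_norm (fun n => (h _).2) ?_
  simp only [map_sub, e1, e2, Submodule.coe_sub]
  have l1 := ((tendsto_iff_norm_sub_tendsto_zero.1 hg).pow 2)
  have l2 := ((tendsto_iff_norm_sub_tendsto_zero.1 hz).pow 2)
  have l3 := ((tendsto_iff_norm_sub_tendsto_zero.1 hux).pow 2)
  simpa using ((l1.add l2).add l3).const_mul K

lemma differentiable_fiberForm_self (B : ℝ) {v : ℝ → ℝ} (hv : PotentialCondition v)
    (u : formDomain B v) : Differentiable ℂ fun κ => fiberForm B hv κ u u := by
  simp only [fiberForm_self]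
  fun_prop

lemma integrable_formPerturbation {B : ℝ} {v : ℝ → ℝ} (p₀ p : ℝ) (u : formDomain B v) :
    Integrable (fun x => 2 * B * x * (p - p₀) * ‖(u : L2R) x‖ ^ 2) volume :=
  ((formDomain.integrable_linear u).const_mul (2 * (p - p₀))).congr
    (Eventually.of_forall fun x => by ring)

lemma formPerturbation_eq {B : ℝ} {v : ℝ → ℝ} (p₀ p : ℝ) (u : formDomain B v) :
    formPerturbation B p₀ p (u : L2R) = (p ^ 2 - p₀ ^ 2) * ‖(u : L2R)‖ ^ 2 +
      2 * (p - p₀) * ∫ x, B * x * ‖(u : L2R) x‖ ^ 2 := by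
  rw [formPerturbation, ← integral_const_mul]
  congr 2
  funext x
  ring

lemma fiberForm_eq_add_formPerturbation (B : ℝ) {v : ℝ → ℝ} (hv : PotentialCondition v)
    (p₀ p : ℝ) (u : formDomain B v) : fiberForm B hv p u u =
      fiberForm B hv p₀ u u + ((formPerturbation B p₀ p (u : L2R) : ℝ) : ℂ) := by
  rw [fiberForm_self, fiberForm_self, formPerturbation_eq]
  push_cast
  ring

lemma exists_formPerturbation_bound (B : ℝ) {v : ℝ → ℝ} (hv : PotentialCondition v)
    (p₀ R ε : ℝ) (hε : 0 < ε) : ∃ δ : ℝ, ∀ p : ℝ, |p - p₀| ≤ R → ∀ u : formDomain B v,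
      |formPerturbation B p₀ p (u : L2R)| ≤
        ε * (fiberForm B hv p₀ u u).re + δ * ‖(u : L2R)‖ ^ 2 := by
  obtain ⟨K, hK, h⟩ := exists_fiberForm_bounds B hv p₀
  -- This gives `|R| θ ≤ ε / 2`; the other factor `2` comes from bounding the weighted norm by twice
  -- the shifted form. Using `|R|` keeps `θ` positive for negative `R`, where the claim is vacuous.
  set θ : ℝ := ε / (2 * (|R| + 1))
  have hθ : 0 < θ := by positivity
  refine ⟨ε * K + |R| * (|R| + 2 * |p₀|) + |R| / θ, fun p hp u => ?_⟩
  have hp' : |p - p₀| ≤ |R| := hp.trans (le_abs_self R)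
  obtain ⟨h1, -⟩ := h u
  have hX := formDomain.abs_integral_linear_le u hθ
  rw [formPerturbation_eq]
  set X := ∫ x, B * x * ‖(u : L2R) x‖ ^ 2
  set n := ‖(u : L2R)‖ ^ 2
  set d := ‖formDomain.weakDeriv u‖ ^ 2
  set s := ‖formDomain.weighted u‖ ^ 2
  have hn : 0 ≤ n := sq_nonneg _
  have hd : 0 ≤ d := sq_nonneg _
  have hs : 0 ≤ s := sq_nonneg _
  have hsq : |p ^ 2 - p₀ ^ 2| ≤ |R| * (|R| + 2 * |p₀|) := by
    rw [show p ^ 2 - p₀ ^ 2 = (p - p₀) * ((p - p₀) + 2 * p₀) by ring, abs_mul]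
    refine mul_le_mul hp' ((abs_add_le _ _).trans ?_) (abs_nonneg _) (abs_nonneg _)
    rw [abs_mul, abs_two]
    gcongr
  have hRθ : |R| * θ ≤ ε / 2 := by
    rw [show |R| * θ = |R| * ε / (2 * (|R| + 1)) by simp only [θ]; ring,
      div_le_iff₀ (by positivity)]
    nlinarith [abs_nonneg R]
  calc |(p ^ 2 - p₀ ^ 2) * n + 2 * (p - p₀) * X|
      ≤ |p ^ 2 - p₀ ^ 2| * n + 2 * |p - p₀| * |X| := by
        refine (abs_add_le _ _).trans_eq ?_
        rw [abs_mul, abs_mul, abs_mul, abs_of_nonneg hn, abs_two]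
    _ ≤ |R| * (|R| + 2 * |p₀|) * n + 2 * |R| * (θ / 2 * s + 1 / (2 * θ) * n) := by
        gcongr
    _ = |R| * (|R| + 2 * |p₀|) * n + |R| * θ * s + |R| / θ * n := by field_simp; ring
    _ ≤ |R| * (|R| + 2 * |p₀|) * n + ε / 2 * (d + s) + |R| / θ * n := by
        gcongr
        linarith
    _ ≤ _ := by nlinarith

/-- The weight is locally integrable, so its product with the compactly supported continuous
function `‖φ‖²` is integrable. -/
lemma mem_formDomain_of_testFunction (B : ℝ) {v : ℝ → ℝ} (hv : PotentialCondition v)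
    {φ : ℝ → ℂ} (hφ : ContDiff ℝ ∞ φ) (hc : HasCompactSupport φ) {u : L2R}
    (hu : u =ᵐ[volume] φ) : u ∈ formDomain B v := by
  have hφ1 : ContDiff ℝ 1 φ := hφ.of_le (by exact_mod_cast le_top)
  have hm : MemLp (deriv φ) 2 volume :=
    (hφ1.continuous_deriv le_rfl).memLp_of_hasCompactSupport hc.deriv
  refine ⟨⟨hm.toLp, (hasWeakDeriv_of_contDiff hφ1).congr hu.symm hm.coeFn_toLp.symm⟩, ?_⟩
  have hae : (fun x => (√(confiningWeight B v x) : ℂ) * u x) =ᵐ[volume]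
      fun x => (√(confiningWeight B v x) : ℂ) * φ x := hu.mono fun x hx => by simp only [hx]
  refine (memLp_congr_ae hae).2 ?_
  have hms : AEStronglyMeasurable (fun x => √(confiningWeight B v x)) volume := by
    refine Real.continuous_sqrt.comp_aestronglyMeasurable ?_
    exact (by fun_prop : AEStronglyMeasurable (fun x : ℝ => B ^ 2 * x ^ 2) volume).add
      hv.aestronglyMeasurable_posPart
  refine (memLp_two_iff_integrable_sq_norm ((Complex.continuous_ofReal.comp_aestronglyMeasurable
    hms).mul hφ.continuous.aestronglyMeasurable)).2 ?_
  have hloc : LocallyIntegrable (confiningWeight B v) := by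
    refine LocallyIntegrable.add (Continuous.locallyIntegrable (by fun_prop)) ?_
    rw [locallyIntegrable_iff]
    intro K hK
    have : IsFiniteMeasure (volume.restrict K) := ⟨by simpa using hK.measure_lt_top⟩
    exact (hv.1 K hK).integrable one_le_two
  have hi := hloc.integrable_smul_left_of_hasCompactSupport (g := fun x => ‖φ x‖ ^ 2)
    (by fun_prop) (hc.comp_left (g := fun z : ℂ => ‖z‖ ^ 2) (by simp))
  refine hi.congr (Eventually.of_forall fun x => ?_)
  simp only [Pi.mul_apply]
  rw [norm_mul, mul_pow, Complex.norm_real, Real.norm_eq_abs, sq_abs,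
    Real.sq_sqrt (confiningWeight_nonneg B v x), smul_eq_mul, mul_comm]

lemma dense_formDomain (B : ℝ) {v : ℝ → ℝ} (hv : PotentialCondition v) :
    Dense (formDomain B v : Set L2R) :=
  (Lp.dense_hasCompactSupport_contDiff (F := ℂ) (μ := (volume : Measure ℝ))
    (p := 2) (by simp)).mono fun u hu => by
      obtain ⟨φ, h, hc, hφ⟩ := hu
      exact mem_formDomain_of_testFunction B hv hφ hc h

/-! ### The operator associated with a form, and closedness of its graph. -/

section FormGraph

variable {H : Type*} [NormedAddCommGroup H] [InnerProductSpace ℂ H]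

/-- The graph of the operator associated with a form. -/
def SesqForm.graph {D : Submodule ℂ H} (t : SesqForm D) : Submodule ℂ (H × H) where
  carrier := {a | ∃ hu : a.1 ∈ D, ∀ v : D, t v ⟨a.1, hu⟩ = ⟪(v : H), a.2⟫_ℂ}
  zero_mem' := ⟨D.zero_mem, fun v => by
    rw [show (⟨(0 : H × H).1, D.zero_mem⟩ : D) = 0 from rfl]; simp⟩
  add_mem' := by
    rintro a b ⟨ha, ha'⟩ ⟨hb, hb'⟩
    refine ⟨D.add_mem ha hb, fun v => ?_⟩
    rw [show (⟨(a + b).1, D.add_mem ha hb⟩ : D) = ⟨a.1, ha⟩ + ⟨b.1, hb⟩ from rfl, map_add, ha', hb',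
      Prod.snd_add, inner_add_right]
  smul_mem' := by
    rintro c a ⟨ha, ha'⟩
    refine ⟨D.smul_mem c ha, fun v => ?_⟩
    rw [show (⟨(c • a).1, D.smul_mem c ha⟩ : D) = c • ⟨a.1, ha⟩ from rfl, map_smul, ha',
      Prod.smul_snd, inner_smul_right, smul_eq_mul]

lemma SesqForm.mem_graph {D : Submodule ℂ H} {t : SesqForm D} {a : H × H} :
    a ∈ t.graph ↔ ∃ hu : a.1 ∈ D, ∀ v : D, t v ⟨a.1, hu⟩ = ⟪(v : H), a.2⟫_ℂ := Iff.rfl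

lemma SesqForm.graph_snd_eq_zero {D : Submodule ℂ H} (t : SesqForm D) (hD : Dense (D : Set H))
    (a : H × H) (ha : a ∈ t.graph) (h0 : a.1 = 0) : a.2 = 0 := by
  obtain ⟨hu, h⟩ := ha
  refine hD.eq_zero_of_inner_right ℂ fun v hv => ?_
  rw [← h ⟨v, hv⟩, show (⟨a.1, hu⟩ : D) = 0 from Subtype.ext h0, map_zero]

/-- The operator associated with a densely defined form. -/
noncomputable def SesqForm.operator {D : Submodule ℂ H} (t : SesqForm D) : H →ₗ.[ℂ] H :=
  t.graph.toLinearPMap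

lemma SesqForm.graph_operator {D : Submodule ℂ H} (t : SesqForm D) (hD : Dense (D : Set H)) :
    t.operator.graph = t.graph :=
  Submodule.toLinearPMap_graph_eq _ (t.graph_snd_eq_zero hD)

lemma SesqForm.isAssociated_operator {D : Submodule ℂ H} (t : SesqForm D)
    (hD : Dense (D : Set H)) : t.IsAssociated t.operator := fun u w => by
  rw [t.graph_operator hD, SesqForm.mem_graph]

lemma SesqForm.polarization {D : Submodule ℂ H} (t : SesqForm D) (v w : D) :
    4 * t v w = t (v + w) (v + w) - t (v - w) (v - w)
      - Complex.I * (t (v + Complex.I • w) (v + Complex.I • w)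
        - t (v - Complex.I • w) (v - Complex.I • w)) := by
  simp only [map_add, map_sub, LinearMap.add_apply, LinearMap.sub_apply, map_smul,
    LinearMap.map_smulₛₗ, LinearMap.smul_apply, smul_eq_mul, Complex.conj_I]
  linear_combination (2 * t v w - 2 * t w v) * Complex.I_sq

end FormGraph

namespace formDomain

variable {B : ℝ} {v : ℝ → ℝ}

/-- The squared norm that makes the form domain a Hilbert space. -/
noncomputable def energy (u : formDomain B v) : ℝ :=
  ‖weakDeriv u‖ ^ 2 + ‖weighted u‖ ^ 2 + ‖(u : L2R)‖ ^ 2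

lemma energy_nonneg (u : formDomain B v) : 0 ≤ energy u := by
  unfold energy; positivity

lemma energy_smul (c : ℂ) (u : formDomain B v) : energy (c • u) = ‖c‖ ^ 2 * energy u := by
  simp only [energy, map_smul, Submodule.coe_smul, norm_smul]
  ring

lemma energy_add_add_energy_sub (u w : formDomain B v) :
    energy (u + w) + energy (u - w) = 2 * (energy u + energy w) := by
  have h1 := parallelogram_law_with_norm ℂ (weakDeriv u) (weakDeriv w)
  have h2 := parallelogram_law_with_norm ℂ (weighted u) (weighted w)
  have h3 := parallelogram_law_with_norm ℂ (u : L2R) (w : L2R)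
  simp only [energy, map_add, map_sub, Submodule.coe_add, Submodule.coe_sub]
  linarith

/-- Polarization expresses `t u w` through four diagonal values, and the parallelogram law sums
their energies. -/
lemma norm_form_le_of_quadratic_bound {t : SesqForm (formDomain B v)} {K : ℝ}
    (h : ∀ u, ‖t u u‖ ≤ K * energy u) (u w : formDomain B v) :
    ‖t u w‖ ≤ K * (energy u + energy w) := by
  have h4 : ‖4 * t u w‖ ≤ K * energy (u + w) + K * energy (u - w)
      + (K * energy (u + Complex.I • w) + K * energy (u - Complex.I • w)) := by
    rw [t.polarization]
    refine (norm_sub_le _ _).trans (add_le_add ((norm_sub_le _ _).trans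
      (add_le_add (h _) (h _))) ?_)
    rw [norm_mul, Complex.norm_I, one_mul]
    exact (norm_sub_le _ _).trans (add_le_add (h _) (h _))
  rw [← mul_add, ← mul_add, energy_add_add_energy_sub, energy_add_add_energy_sub, energy_smul,
    norm_mul, Complex.norm_I, Complex.norm_ofNat] at h4
  linarith

/-- Replacing `(u, w)` by `(c u, c⁻¹ w)` leaves the form value unchanged but weights the two
energies by `c²` and `c⁻²`; this scaling takes the place of a Cauchy–Schwarz inequality for `t`. -/
lemma tendsto_form_of_energy_tendsto {t : SesqForm (formDomain B v)} {K : ℝ} (hK : 0 ≤ K)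
    (h : ∀ u, ‖t u u‖ ≤ K * energy u) {w : ℕ → formDomain B v}
    (hw : Tendsto (fun n => energy (w n)) atTop (𝓝 0)) (u : formDomain B v) :
    Tendsto (fun n => t u (w n)) atTop (𝓝 0) := by
  have hscale : ∀ c : ℝ, 0 < c → ∀ n, ‖t u (w n)‖ ≤
      K * (c ^ 2 * energy u + (c⁻¹) ^ 2 * energy (w n)) := by
    intro c hc n
    have e : t u (w n) = t ((c : ℂ) • u) (((c⁻¹ : ℝ) : ℂ) • w n) := by
      rw [LinearMap.map_smulₛₗ t, LinearMap.smul_apply, map_smul, smul_smul, Complex.conj_ofReal,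
        ← Complex.ofReal_mul, mul_inv_cancel₀ hc.ne', Complex.ofReal_one, one_smul]
    rw [e]
    refine (norm_form_le_of_quadratic_bound h _ _).trans_eq ?_
    rw [energy_smul, energy_smul, Complex.norm_real, Complex.norm_real, Real.norm_eq_abs,
      Real.norm_eq_abs, sq_abs, sq_abs]
  rw [tendsto_zero_iff_norm_tendsto_zero, Metric.tendsto_atTop]
  intro ε hε
  -- Chosen so that `K c² energy u ≤ ε / 2`; the other term tends to zero for this fixed `c`.
  set c : ℝ := √(ε / (2 * (K * energy u + 1)))
  have hKu : 0 ≤ K * energy u := mul_nonneg hK (energy_nonneg u)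
  have hq : 0 < ε / (2 * (K * energy u + 1)) := by positivity
  have hc : 0 < c := Real.sqrt_pos.2 hq
  have hlim : Tendsto (fun n => K * (c⁻¹) ^ 2 * energy (w n)) atTop (𝓝 0) := by
    have := hw.const_mul (K * (c⁻¹) ^ 2)
    rwa [mul_zero] at this
  obtain ⟨N, hN⟩ := (hlim.eventually (gt_mem_nhds (half_pos hε))).exists_forall_of_atTop
  refine ⟨N, fun n hn => ?_⟩
  rw [Real.dist_eq, sub_zero, abs_of_nonneg (norm_nonneg _)]
  have h1 : K * (c ^ 2 * energy u) ≤ ε / 2 := by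
    rw [Real.sq_sqrt hq.le, div_mul_eq_mul_div, mul_div_assoc', div_le_iff₀ (by positivity)]
    nlinarith
  have h2 := hN n hn
  have h3 := hscale c hc n
  linarith

end formDomain

/-- The operator associated with the fiber form is closed. -/
lemma isClosed_graph_fiberForm (B : ℝ) {v : ℝ → ℝ} (hv : PotentialCondition v) (κ : ℂ) :
    IsClosed ((fiberForm B hv κ).graph : Set (L2R × L2R)) := by
  rw [← isSeqClosed_iff_isClosed]
  rintro a ⟨x, y⟩ ha hlim
  choose hu ht using ha
  have hlim1 : Tendsto (fun n => (a n).1) atTop (𝓝 x) := (continuous_fst.tendsto _).comp hlim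
  have hlim2 : Tendsto (fun n => (a n).2) atTop (𝓝 y) := (continuous_snd.tendsto _).comp hlim
  set u : ℕ → formDomain B v := fun n => ⟨(a n).1, hu n⟩
  -- On the graph the form of a difference is an inner product of differences, so convergence of the
  -- pairs in `L² × L²` forces the sequence to be form-Cauchy.
  have hform : ∀ k : ℕ × ℕ, fiberForm B hv κ (u k.1 - u k.2) (u k.1 - u k.2) =
      ⟪(a k.1).1 - (a k.2).1, (a k.1).2 - (a k.2).2⟫_ℂ := by
    intro k
    rw [map_sub (fiberForm B hv κ (u k.1 - u k.2)), ht, ht, ← inner_sub_right]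
    rfl
  obtain ⟨K, hK, hb⟩ := exists_fiberForm_bounds B hv κ
  have hsub : ∀ {b : ℕ → L2R} {z : L2R}, Tendsto b atTop (𝓝 z) →
      Tendsto (fun k : ℕ × ℕ => b k.1 - b k.2) atTop (𝓝 0) := by
    intro b z hz
    rw [← prod_atTop_atTop_eq]
    simpa using (hz.comp tendsto_fst).sub (hz.comp tendsto_snd)
  obtain ⟨hx, hxt⟩ := fiberForm_isClosedForm B hv κ u x hlim1 (by
    simp only [hform]
    simpa using (hsub hlim1).inner (𝕜 := ℂ) (hsub hlim2))
  refine ⟨hx, fun η => ?_⟩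
  have l3 : Tendsto (fun n => ‖((u n - ⟨x, hx⟩ : formDomain B v) : L2R)‖ ^ 2) atTop (𝓝 0) := by
    simpa using (tendsto_iff_norm_sub_tendsto_zero.1 hlim1).pow 2
  have hre := (Complex.continuous_re.tendsto 0).comp hxt
  have hle : ∀ z : formDomain B v, formDomain.energy z ≤
      2 * ((fiberForm B hv κ z z).re + K * ‖(z : L2R)‖ ^ 2) + ‖(z : L2R)‖ ^ 2 := by
    intro z
    rw [formDomain.energy]
    linarith [(hb z).1]
  have hlim3 := ((hre.add (l3.const_mul K)).const_mul 2).add l3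
  simp only [Complex.zero_re, mul_zero, add_zero] at hlim3
  have hE : Tendsto (fun n => formDomain.energy (u n - ⟨x, hx⟩)) atTop (𝓝 0) :=
    squeeze_zero (fun _ => formDomain.energy_nonneg _) (fun n => hle _) hlim3
  have h0 := formDomain.tendsto_form_of_energy_tendsto hK (fun z => (hb z).2) hE η
  have h1 : Tendsto (fun n => ⟪(η : L2R), (a n).2⟫_ℂ) atTop (𝓝 (fiberForm B hv κ η ⟨x, hx⟩)) := by
    have := h0.add_const (fiberForm B hv κ η ⟨x, hx⟩)
    rw [zero_add] at this
    refine this.congr fun n => ?_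
    rw [map_sub, sub_add_cancel]
    exact ht n η
  exact tendsto_nhds_unique h1 (tendsto_const_nhds.inner hlim2)

/-! ### The minimal operator is contained in the form operator. -/

lemma inner_testFunction_deriv {η g : L2R} (hη : HasWeakDeriv η g) {φ : ℝ → ℂ}
    (hφ : ContDiff ℝ ∞ φ) (hc : HasCompactSupport φ) :
    ∫ x, starRingEnd ℂ (g x) * φ x = -∫ x, starRingEnd ℂ (η x) * deriv φ x := by
  have h := hη (fun x => starRingEnd ℂ (φ x)) (Complex.conjCLE.contDiff.comp hφ)
    (hc.comp_left (g := starRingEnd ℂ) (map_zero _))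
  have hd : ∀ x, deriv (fun x => starRingEnd ℂ (φ x)) x = starRingEnd ℂ (deriv φ x) := fun x =>
    ((hφ.differentiable (by simp) x).hasDerivAt.star).deriv
  have h2 := congrArg (starRingEnd ℂ) h
  rw [map_neg, ← integral_conj, ← integral_conj] at h2
  simp only [hd, map_mul, Complex.conj_conj] at h2
  simp only [mul_comm (starRingEnd ℂ _)]
  rw [h2, neg_neg]

lemma fiberPotential_ofReal (B : ℝ) (v : ℝ → ℝ) (p x : ℝ) :
    fiberPotential B v p x = (((p + B * x) ^ 2 + v x : ℝ) : ℂ) := by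
  rw [fiberPotential]; push_cast; ring

lemma fiberMinimalGraph_le_graph (B : ℝ) {v : ℝ → ℝ} (hv : PotentialCondition v) (p : ℝ) :
    fiberMinimalGraph B v p ≤ (fiberForm B hv p).graph := by
  rintro ⟨u, w⟩ ⟨φ, hφ, hc, hu, hw⟩
  have hφ' : ContDiff ℝ ∞ (deriv φ) := (contDiff_infty_iff_deriv.1 hφ).2
  have hφ'' : ContDiff ℝ ∞ (deriv (deriv φ)) := (contDiff_infty_iff_deriv.1 hφ').2
  have hmem := mem_formDomain_of_testFunction B hv hφ hc hu
  refine ⟨hmem, fun η => ?_⟩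
  have hm : MemLp (deriv φ) 2 volume := hφ'.continuous.memLp_of_hasCompactSupport hc.deriv
  have hd : formDomain.weakDeriv (⟨u, hmem⟩ : formDomain B v) = hm.toLp :=
    formDomain.eq_of_hasWeakDeriv (formDomain.hasWeakDeriv (⟨u, hmem⟩ : formDomain B v))
      ((hasWeakDeriv_of_contDiff (hφ.of_le (by exact_mod_cast le_top))).congr hu.symm
        hm.coeFn_toLp.symm)
  have h1 : ⟪formDomain.weakDeriv η, formDomain.weakDeriv (⟨u, hmem⟩ : formDomain B v)⟫_ℂ =
      -∫ x, starRingEnd ℂ ((η : L2R) x) * deriv (deriv φ) x := by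
    rw [← inner_testFunction_deriv (formDomain.hasWeakDeriv η) hφ' hc.deriv, hd, L2.inner_def]
    refine integral_congr_ae ?_
    filter_upwards [hm.coeFn_toLp] with x hx
    rw [hx, RCLike.inner_apply, mul_comm]
  have i1 : Integrable (fun x => starRingEnd ℂ ((η : L2R) x) * deriv (deriv φ) x) := by
    have := (hφ''.continuous.memLp_of_hasCompactSupport (p := 2) (μ := volume)
      hc.deriv.deriv).integrable_mul (Lp.memLp (η : L2R)).star
    exact this.congr (Eventually.of_forall fun x => mul_comm _ _)
  have i2 := formDomain.integrable_fiberPotential hv (p : ℂ) η (⟨u, hmem⟩ : formDomain B v)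
  rw [fiberForm_apply, h1, L2.inner_def, neg_add_eq_sub, ← integral_sub i2 i1]
  refine integral_congr_ae ?_
  filter_upwards [hu, hw] with x hx hx'
  rw [RCLike.inner_apply, hx', iteratedDeriv_succ, iteratedDeriv_one]
  have hx : u x = φ x := hx
  rw [hx, fiberPotential_ofReal]
  ring

/-! ### Test functions are an operator core. -/

lemma memLp_two_restrict_of_continuous {f : ℝ → ℝ} (hf : Continuous f) {K : Set ℝ}
    (hK : IsCompact K) : MemLp f 2 (volume.restrict K) :=
  (memLp_two_iff_integrable_sq hf.aestronglyMeasurable).2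
    ((hf.pow 2).continuousOn.integrableOn_compact hK)

lemma PotentialCondition.memLp_realPotential {v : ℝ → ℝ} (hv : PotentialCondition v) (B p : ℝ)
    {K : Set ℝ} (hK : IsCompact K) :
    MemLp (fun x => (p + B * x) ^ 2 + v x) 2 (volume.restrict K) :=
  (memLp_two_restrict_of_continuous (by fun_prop) hK).add (hv.memLp_restrict hK)

lemma memLp_mul_of_hasCompactSupport {W : ℝ → ℝ}
    (hW : ∀ K : Set ℝ, IsCompact K → MemLp W 2 (volume.restrict K)) {φ : ℝ → ℂ}
    (hφ : Continuous φ) (hc : HasCompactSupport φ) : MemLp (fun x => (W x : ℂ) * φ x) 2 volume := by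
  have hK := hc.isCompact
  obtain ⟨M, hM⟩ := hc.exists_bound_of_continuous hφ
  have hWc : MemLp (fun x => (W x : ℂ)) 2 (volume.restrict (tsupport φ)) := (hW _ hK).ofReal
  have h1 : MemLp (fun x => (W x : ℂ) * φ x) 2 (volume.restrict (tsupport φ)) := by
    refine MemLp.of_le_mul (c := M) hWc
      (hWc.aestronglyMeasurable.mul hφ.aestronglyMeasurable) (Eventually.of_forall fun x => ?_)
    rw [norm_mul, mul_comm]
    exact mul_le_mul_of_nonneg_right (hM x) (norm_nonneg _)
  rw [← memLp_indicator_iff_restrict (isClosed_tsupport φ).measurableSet] at h1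
  refine (memLp_congr_ae (Eventually.of_forall fun x => ?_)).1 h1
  by_cases hx : x ∈ tsupport φ
  · rw [Set.indicator_of_mem hx]
  · simp only [Set.indicator_of_notMem hx, image_eq_zero_of_notMem_tsupport hx, mul_zero]

lemma hasDerivAt_const_add_integral {f : ℝ → ℂ} (hf : Continuous f) (c : ℂ) (x : ℝ) :
    HasDerivAt (fun x => c + ∫ t in (0 : ℝ)..x, f t) (f x) x :=
  (intervalIntegral.integral_hasDerivAt_right (hf.intervalIntegrable _ _)
    (hf.stronglyMeasurableAtFilter _ _) hf.continuousAt).const_add c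

lemma contDiff_const_add_integral {f : ℝ → ℂ} (hf : ContDiff ℝ ∞ f) (c : ℂ) :
    ContDiff ℝ ∞ (fun x => c + ∫ t in (0 : ℝ)..x, f t) := by
  refine contDiff_infty_iff_deriv.2
    ⟨fun x => (hasDerivAt_const_add_integral hf.continuous c x).differentiableAt, ?_⟩
  rwa [funext fun x => (hasDerivAt_const_add_integral hf.continuous c x).deriv]

lemma L2R.norm_le_of_ae_le {f h : L2R} {F : ℝ → ℝ} (hF : MemLp F 2 volume) {M e : ℝ}
    (he : 0 ≤ e) (hle : ∀ᵐ x, ‖f x‖ ≤ M * ‖h x‖ + e * F x) :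
    ‖f‖ ≤ |M| * ‖h‖ + e * (eLpNorm F 2 volume).toReal := by
  have hh := (Lp.memLp h).norm
  have h1 : eLpNorm f 2 volume ≤ ‖M‖ₑ * eLpNorm h 2 volume + ‖e‖ₑ * eLpNorm F 2 volume := by
    refine (eLpNorm_mono_ae_real hle).trans ?_
    refine (eLpNorm_add_le (f := fun x => M * ‖h x‖) (g := fun x => e * F x)
      (hh.const_mul M).aestronglyMeasurable (hF.const_mul e).aestronglyMeasurable
      one_le_two).trans ?_
    have a1 := eLpNorm_const_smul M (fun x => ‖h x‖) 2 volume
    have a2 := eLpNorm_const_smul e F 2 volume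
    rw [eLpNorm_norm] at a1
    exact add_le_add a1.le a2.le
  have h2 := ENNReal.toReal_mono (ENNReal.add_ne_top.2
    ⟨ENNReal.mul_ne_top enorm_ne_top (Lp.memLp h).eLpNorm_ne_top,
      ENNReal.mul_ne_top enorm_ne_top hF.eLpNorm_ne_top⟩) h1
  rw [ENNReal.toReal_add (ENNReal.mul_ne_top enorm_ne_top (Lp.memLp h).eLpNorm_ne_top)
    (ENNReal.mul_ne_top enorm_ne_top hF.eLpNorm_ne_top), ENNReal.toReal_mul, ENNReal.toReal_mul,
    toReal_enorm, toReal_enorm, Real.norm_eq_abs, Real.norm_eq_abs, abs_of_nonneg he] at h2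
  exact h2

/-- Error control for primitives in terms of the `L²` error of the integrands. -/
lemma norm_integral_sub_integral_le {k G : ℝ → ℂ} (hk : LocallyIntegrable k)
    (hG : LocallyIntegrable G) {L : ℝ} (h : L2R)
    (hh : ∀ᵐ x, x ∈ Set.Icc (-L) L → h x = k x - G x) {x : ℝ} (hx : x ∈ Set.Icc (-L) L) :
    ‖(∫ t in (0 : ℝ)..x, G t) - ∫ t in (0 : ℝ)..x, k t‖ ≤ √L * ‖h‖ := by
  have hL : 0 ≤ L := by linarith [hx.1, hx.2]
  have ik : ∀ {f : ℝ → ℂ}, LocallyIntegrable f → ∀ x y, IntervalIntegrable f volume x y :=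
    fun hf x y => (hf.integrableOn_isCompact isCompact_uIcc).intervalIntegrable
  have hle : ∀ {a b : ℝ}, a ≤ b → -L ≤ a → b ≤ L → b - a ≤ L →
      ‖∫ t in a..b, (k t - G t)‖ ≤ √L * ‖h‖ := by
    intro a b hab ha hb hba
    have e : ∫ t in a..b, (k t - G t) = ∫ t in a..b, h t := by
      refine intervalIntegral.integral_congr_ae ?_
      filter_upwards [hh] with t ht hmem
      rw [Set.uIoc_of_le hab] at hmem
      exact (ht ⟨ha.trans hmem.1.le, hmem.2.trans hb⟩).symm
    rw [e]
    refine (intervalIntegral.norm_integral_le_integral_norm hab).trans ?_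
    refine Real.le_sqrt_of_sq_le (L2R.sq_integral_norm_le h hab) |>.trans ?_
    rw [Real.sqrt_mul (sub_nonneg.2 hab), Real.sqrt_sq (norm_nonneg _)]
    exact mul_le_mul_of_nonneg_right (Real.sqrt_le_sqrt hba) (norm_nonneg _)
  rw [norm_sub_rev, ← intervalIntegral.integral_sub (ik hk _ _) (ik hG _ _)]
  rcases le_total 0 x with h0 | h0
  · exact hle h0 (by linarith) hx.2 (by linarith [hx.2])
  · rw [intervalIntegral.integral_symm, norm_neg]
    exact hle h0 hx.1 (by linarith) (by linarith [hx.1])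

lemma norm_integral_sub_integral_le_of_bound {f g : ℝ → ℂ} (hf : Continuous f)
    (hg : Continuous g) {L e : ℝ} (he : 0 ≤ e) (h : ∀ x ∈ Set.Icc (-L) L, ‖f x - g x‖ ≤ e) {x : ℝ}
    (hx : x ∈ Set.Icc (-L) L) :
    ‖(∫ t in (0 : ℝ)..x, f t) - ∫ t in (0 : ℝ)..x, g t‖ ≤ L * e := by
  have hL : 0 ≤ L := by linarith [hx.1, hx.2]
  rw [← intervalIntegral.integral_sub (hf.intervalIntegrable _ _) (hg.intervalIntegrable _ _)]
  refine (intervalIntegral.norm_integral_le_of_norm_le_const (C := e) fun t ht => h t ?_).trans ?_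
  · have := Set.uIoc_subset_uIcc ht
    rw [← Set.uIcc_of_le (by linarith)]
    refine Set.uIcc_subset_uIcc ?_ ?_ this <;> rw [Set.uIcc_of_le (by linarith)]
    · constructor <;> linarith
    · exact hx
  · rw [sub_zero, mul_comm]
    exact mul_le_mul_of_nonneg_right (abs_le.2 hx) he

/-- A smoothly truncated `H²_loc` function belongs to the closure of the minimal operator. -/
lemma truncation_mem_closure_fiberMinimalGraph {B : ℝ} {v : ℝ → ℝ} (hv : PotentialCondition v)
    {p : ℝ} {u g k : ℝ → ℂ} {c c' : ℂ} (hk : LocallyIntegrable k)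
    (hk2 : ∀ K : Set ℝ, IsCompact K → MemLp k 2 (volume.restrict K))
    (hg : ∀ x, g x = c' + ∫ t in (0 : ℝ)..x, k t) (hu : ∀ x, u x = c + ∫ t in (0 : ℝ)..x, g t)
    {χ : ℝ → ℂ} (hχ : ContDiff ℝ ∞ χ) (hχc : HasCompactSupport χ) {a b : L2R}
    (ha : a =ᵐ[volume] fun x => χ x * u x)
    (hb : b =ᵐ[volume] fun x => χ x * ((((p + B * x) ^ 2 + v x : ℝ) : ℂ) * u x - k x)
      - 2 * deriv χ x * g x - deriv (deriv χ) x * u x) :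
    (a, b) ∈ (fiberMinimalGraph B v p).topologicalClosure := by
  set W : ℝ → ℝ := fun x => (p + B * x) ^ 2 + v x
  have hW : ∀ K : Set ℝ, IsCompact K → MemLp W 2 (volume.restrict K) := fun K hK =>
    hv.memLp_realPotential B p hK
  have hgc : Continuous g := by
    rw [funext hg]; exact continuous_const.add (continuous_integral_of_locallyIntegrable hk 0)
  have hχ' : ContDiff ℝ ∞ (deriv χ) := (contDiff_infty_iff_deriv.1 hχ).2
  have hχ'' : ContDiff ℝ ∞ (deriv (deriv χ)) := (contDiff_infty_iff_deriv.1 hχ').2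
  obtain ⟨M₀, hM₀⟩ := hχc.exists_bound_of_continuous hχ.continuous
  obtain ⟨M₁, hM₁⟩ := hχc.deriv.exists_bound_of_continuous hχ'.continuous
  obtain ⟨M₂, hM₂⟩ := hχc.deriv.deriv.exists_bound_of_continuous hχ''.continuous
  have hM₀' : 0 ≤ M₀ := (norm_nonneg _).trans (hM₀ 0)
  have hM₁' : 0 ≤ M₁ := (norm_nonneg _).trans (hM₁ 0)
  have hM₂' : 0 ≤ M₂ := (norm_nonneg _).trans (hM₂ 0)
  obtain ⟨L, hL, hs⟩ := hχc.exists_tsupport_subset_Ioo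
  have hz : ∀ x, x ∉ Set.Icc (-L) L → χ x = 0 ∧ deriv χ x = 0 ∧ deriv (deriv χ) x = 0 := by
    intro x hx
    have h0 : x ∉ tsupport χ := fun h => hx (Set.Ioo_subset_Icc_self (hs h))
    have h1 : x ∉ tsupport (deriv χ) := fun h => h0 (tsupport_deriv_subset h)
    have h2 : x ∉ tsupport (deriv (deriv χ)) := fun h => h1 (tsupport_deriv_subset h)
    exact ⟨image_eq_zero_of_notMem_tsupport h0, image_eq_zero_of_notMem_tsupport h1,
      image_eq_zero_of_notMem_tsupport h2⟩
  -- `‖h‖ F₁` and `‖h‖ F₂` will dominate the errors caused by replacing `k` with a smooth `G`, where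
  -- `h` is the `L²` error on `[-L, L]`; the only term outside them is `M₀ ‖h x‖`.
  set F₁ : ℝ → ℝ := (Set.Icc (-L) L).indicator fun _ => M₀ * (L * √L)
  set F₂ : ℝ → ℝ := (Set.Icc (-L) L).indicator fun x =>
    2 * M₁ * √L + M₂ * (L * √L) + M₀ * (L * √L) * ‖W x‖
  have hF₁ : MemLp F₁ 2 volume :=
    (memLp_indicator_iff_restrict measurableSet_Icc).2
      (memLp_two_restrict_of_continuous continuous_const isCompact_Icc)
  have hF₂ : MemLp F₂ 2 volume :=
    (memLp_indicator_iff_restrict measurableSet_Icc).2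
      ((memLp_two_restrict_of_continuous continuous_const isCompact_Icc).add
        ((hW _ isCompact_Icc).norm.const_mul _))
  set N₁ := (eLpNorm F₁ 2 volume).toReal
  set N₂ := (eLpNorm F₂ 2 volume).toReal
  have hN₁ : 0 ≤ N₁ := ENNReal.toReal_nonneg
  have hN₂ : 0 ≤ N₂ := ENNReal.toReal_nonneg
  refine Metric.mem_closure_iff.2 fun ε hε => ?_
  set e : ℝ := ε / (2 * (M₀ + N₁ + N₂ + 1))
  have he : 0 < e := by positivity
  have hkI : MemLp ((Set.Icc (-L) L).indicator k) 2 volume :=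
    (memLp_indicator_iff_restrict measurableSet_Icc).2 (hk2 _ isCompact_Icc)
  obtain ⟨G, hGc, hG, hGe⟩ := hkI.exist_eLpNorm_sub_le (by simp) one_le_two he
  have hGm : MemLp G 2 volume := hG.continuous.memLp_of_hasCompactSupport hGc
  set h : L2R := (hkI.sub hGm).toLp
  have hne : ‖h‖ ≤ e := by
    rw [Lp.norm_toLp]
    exact ENNReal.toReal_le_of_le_ofReal he.le hGe
  have hh : ∀ᵐ x, x ∈ Set.Icc (-L) L → h x = k x - G x := by
    filter_upwards [(hkI.sub hGm).coeFn_toLp] with x hx hxI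
    rw [hx, Pi.sub_apply, Set.indicator_of_mem hxI]
  -- Integrating `G` twice with the constants `c'`, `c` of `g` and `u` gives smooth functions
  -- uniformly close to `g` and `u` on `[-L, L]`.
  set Γ : ℝ → ℂ := fun x => c' + ∫ t in (0 : ℝ)..x, G t
  set Φ : ℝ → ℂ := fun x => c + ∫ t in (0 : ℝ)..x, Γ t
  have hΓ : ContDiff ℝ ∞ Γ := contDiff_const_add_integral hG c'
  have hΦ : ContDiff ℝ ∞ Φ := contDiff_const_add_integral hΓ c
  have hΓd : ∀ x, HasDerivAt Γ (G x) x := hasDerivAt_const_add_integral hG.continuous c'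
  have hΦd : ∀ x, HasDerivAt Φ (Γ x) x := hasDerivAt_const_add_integral hΓ.continuous c
  have hΓg : ∀ x ∈ Set.Icc (-L) L, ‖Γ x - g x‖ ≤ √L * ‖h‖ := fun x hx => by
    rw [hg x, add_sub_add_left_eq_sub]
    exact norm_integral_sub_integral_le hk hG.continuous.locallyIntegrable h hh hx
  have hΦu : ∀ x ∈ Set.Icc (-L) L, ‖Φ x - u x‖ ≤ L * (√L * ‖h‖) := fun x hx => by
    rw [hu x, add_sub_add_left_eq_sub]
    exact norm_integral_sub_integral_le_of_bound hΓ.continuous hgc (by positivity) hΓg hx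
  set φ : ℝ → ℂ := fun x => χ x * Φ x
  have hφ : ContDiff ℝ ∞ φ := hχ.mul hΦ
  have hφc : HasCompactSupport φ := hχc.mul_right
  have hχd : ∀ x, HasDerivAt χ (deriv χ x) x := fun x =>
    (hχ.differentiable (by simp) x).hasDerivAt
  have hχd' : ∀ x, HasDerivAt (deriv χ) (deriv (deriv χ) x) x := fun x =>
    (hχ'.differentiable (by simp) x).hasDerivAt
  have hφ1 : deriv φ = fun x => deriv χ x * Φ x + χ x * Γ x :=
    funext fun x => ((hχd x).mul (hΦd x)).deriv
  have hφ2 : iteratedDeriv 2 φ = fun x => (deriv (deriv χ) x * Φ x + deriv χ x * Γ x) +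
      (deriv χ x * Γ x + χ x * G x) := by
    rw [iteratedDeriv_succ, iteratedDeriv_one, hφ1]
    exact funext fun x => (((hχd' x).mul (hΦd x)).add ((hχd x).mul (hΓd x))).deriv
  have hm1 : MemLp φ 2 volume := hφ.continuous.memLp_of_hasCompactSupport hφc
  have hm2 : MemLp (iteratedDeriv 2 φ) 2 volume := by
    rw [iteratedDeriv_succ, iteratedDeriv_one]
    exact (contDiff_infty_iff_deriv.1 (contDiff_infty_iff_deriv.1 hφ).2).2.continuous
      |>.memLp_of_hasCompactSupport hφc.deriv.deriv
  have hm3 : MemLp (fun x => -iteratedDeriv 2 φ x + (W x : ℂ) * φ x) 2 volume :=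
    hm2.neg.add (memLp_mul_of_hasCompactSupport hW hφ.continuous hφc)
  refine ⟨(hm1.toLp, hm3.toLp), ⟨φ, hφ, hφc, hm1.coeFn_toLp, hm3.coeFn_toLp⟩, ?_⟩
  have d1 : ‖a - hm1.toLp‖ ≤ |0| * ‖h‖ + ‖h‖ * N₁ := by
    refine L2R.norm_le_of_ae_le hF₁ (norm_nonneg _) ?_
    filter_upwards [Lp.coeFn_sub a hm1.toLp, ha, hm1.coeFn_toLp] with x h1 h2 h3
    rw [h1, Pi.sub_apply, h2, h3, ← mul_sub, norm_mul, zero_mul, zero_add]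
    by_cases hx : x ∈ Set.Icc (-L) L
    · simp only [F₁, Set.indicator_of_mem hx]
      rw [norm_sub_rev]
      calc ‖χ x‖ * ‖Φ x - u x‖ ≤ M₀ * (L * (√L * ‖h‖)) :=
            mul_le_mul (hM₀ x) (hΦu x hx) (norm_nonneg _) hM₀'
        _ = _ := by ring
    · simp [F₁, Set.indicator_of_notMem hx, (hz x hx).1]
  have d2 : ‖b - hm3.toLp‖ ≤ |M₀| * ‖h‖ + ‖h‖ * N₂ := by
    refine L2R.norm_le_of_ae_le hF₂ (norm_nonneg _) ?_
    filter_upwards [Lp.coeFn_sub b hm3.toLp, hb, hm3.coeFn_toLp, hh] with x h1 h2 h3 h4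
    rw [h1, Pi.sub_apply, h2, h3, hφ2]
    by_cases hx : x ∈ Set.Icc (-L) L
    · have e1 : χ x * ((W x : ℂ) * u x - k x) - 2 * deriv χ x * g x - deriv (deriv χ) x * u x -
          (-(deriv (deriv χ) x * Φ x + deriv χ x * Γ x + (deriv χ x * Γ x + χ x * G x)) +
            (W x : ℂ) * φ x) =
          -(χ x * h x) + 2 * (deriv χ x * (Γ x - g x)) + deriv (deriv χ) x * (Φ x - u x)
            - χ x * (Φ x - u x) * W x := by
        rw [h4 hx]; simp only [φ]; ring
      rw [e1]
      simp only [F₂, Set.indicator_of_mem hx]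
      have b1 : ‖-(χ x * h x)‖ ≤ M₀ * ‖h x‖ := by
        rw [norm_neg, norm_mul]; exact mul_le_mul_of_nonneg_right (hM₀ x) (norm_nonneg _)
      have b2 : ‖2 * (deriv χ x * (Γ x - g x))‖ ≤ 2 * (M₁ * (√L * ‖h‖)) := by
        rw [norm_mul, norm_mul, Complex.norm_ofNat]
        exact mul_le_mul_of_nonneg_left
          (mul_le_mul (hM₁ x) (hΓg x hx) (norm_nonneg _) hM₁') (by norm_num)
      have b3 : ‖deriv (deriv χ) x * (Φ x - u x)‖ ≤ M₂ * (L * (√L * ‖h‖)) := by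
        rw [norm_mul]; exact mul_le_mul (hM₂ x) (hΦu x hx) (norm_nonneg _) hM₂'
      have b4 : ‖χ x * (Φ x - u x) * W x‖ ≤ M₀ * (L * (√L * ‖h‖)) * ‖W x‖ := by
        rw [norm_mul, norm_mul, Complex.norm_real]
        exact mul_le_mul_of_nonneg_right
          (mul_le_mul (hM₀ x) (hΦu x hx) (norm_nonneg _) hM₀') (norm_nonneg _)
      calc _ ≤ M₀ * ‖h x‖ + 2 * (M₁ * (√L * ‖h‖)) + M₂ * (L * (√L * ‖h‖))
            + M₀ * (L * (√L * ‖h‖)) * ‖W x‖ :=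
            (norm_sub_le _ _).trans (add_le_add (norm_add₃_le.trans
              (add_le_add (add_le_add b1 b2) b3)) b4)
        _ = _ := by ring
    · obtain ⟨z0, z1, z2⟩ := hz x hx
      simp only [F₂, Set.indicator_of_notMem hx, φ, z0, z1, z2]
      simp only [zero_mul, mul_zero, sub_zero, add_zero, neg_zero, norm_zero]
      positivity
  rw [abs_zero, zero_mul, zero_add] at d1
  rw [abs_of_nonneg hM₀'] at d2
  have he2 : e * (M₀ + N₁ + N₂ + 1) < ε := by
    have : e * (M₀ + N₁ + N₂ + 1) = ε / 2 := by simp only [e]; field_simp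
    linarith
  have hn := norm_nonneg h
  rw [Prod.dist_eq, max_lt_iff, dist_eq_norm, dist_eq_norm]
  constructor
  · refine lt_of_le_of_lt (d1.trans ?_) he2
    exact mul_le_mul hne (by linarith) hN₁ he.le
  · refine lt_of_le_of_lt (d2.trans ?_) he2
    rw [mul_comm M₀, ← mul_add]
    exact mul_le_mul hne (by linarith) (by positivity) he.le

/-- Dilates `β (x / (n + 1))` of one bump: each derivative brings a factor `1 / (n + 1) ≤ 1`, which
makes the bounds uniform in `n`, and every point eventually lies where the bump is locally `1`. -/
lemma exists_smooth_cutoff_seq : ∃ (χ : ℕ → ℝ → ℂ) (M : ℝ), 0 ≤ M ∧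
    (∀ n, ContDiff ℝ ∞ (χ n)) ∧ (∀ n, HasCompactSupport (χ n)) ∧
    (∀ n x, ‖χ n x‖ ≤ M ∧ ‖deriv (χ n) x‖ ≤ M ∧ ‖deriv (deriv (χ n)) x‖ ≤ M) ∧
    ∀ x, ∀ᶠ n in atTop, χ n x = 1 ∧ deriv (χ n) x = 0 ∧ deriv (deriv (χ n)) x = 0 := by
  let b : ContDiffBump (0 : ℝ) := ⟨1, 2, one_pos, one_lt_two⟩
  set β : ℝ → ℂ := fun x => (b x : ℂ)
  have hβ : ContDiff ℝ ∞ β := Complex.ofRealCLM.contDiff.comp b.contDiff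
  have hβc : HasCompactSupport β :=
    b.hasCompactSupport.comp_left (g := fun x : ℝ => (x : ℂ)) (by simp)
  have hβ' : ContDiff ℝ ∞ (deriv β) := (contDiff_infty_iff_deriv.1 hβ).2
  have hβ'' : ContDiff ℝ ∞ (deriv (deriv β)) := (contDiff_infty_iff_deriv.1 hβ').2
  obtain ⟨M₀, hM₀⟩ := hβc.exists_bound_of_continuous hβ.continuous
  obtain ⟨M₁, hM₁⟩ := hβc.deriv.exists_bound_of_continuous hβ'.continuous
  obtain ⟨M₂, hM₂⟩ := hβc.deriv.deriv.exists_bound_of_continuous hβ''.continuous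
  have hM₀' : 0 ≤ M₀ := (norm_nonneg _).trans (hM₀ 0)
  have hM₁' : 0 ≤ M₁ := (norm_nonneg _).trans (hM₁ 0)
  have hM₂' : 0 ≤ M₂ := (norm_nonneg _).trans (hM₂ 0)
  have hone : ∀ x ∈ Metric.ball (0 : ℝ) 1, β =ᶠ[𝓝 x] fun _ => 1 := by
    intro x hx
    filter_upwards [Metric.isOpen_ball.mem_nhds hx] with y hy
    simp only [β, b.one_of_mem_closedBall (Metric.ball_subset_closedBall hy), Complex.ofReal_one]
  set c : ℕ → ℝ := fun n => 1 / ((n : ℝ) + 1)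
  have hc0 : ∀ n, 0 < c n := fun n => Nat.one_div_pos_of_nat
  have hc1 : ∀ n, c n ≤ 1 := fun n => by
    simp only [c]; rw [div_le_one (by positivity)]; linarith [n.cast_nonneg (α := ℝ)]
  have hd1 : ∀ n, deriv (fun x => β (c n * x)) = fun x => c n • deriv β (c n * x) := fun n =>
    funext fun x => deriv_comp_mul_left (c n) β x
  have hd2 : ∀ n, deriv (deriv (fun x => β (c n * x))) =
      fun x => c n • c n • deriv (deriv β) (c n * x) := fun n => by
    rw [hd1]
    funext x
    have h := (((hβ'.differentiable (by simp)) (c n * x)).hasDerivAt.scomp x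
      ((hasDerivAt_id x).const_mul (c n))).const_smul (c n)
    rw [mul_one] at h
    exact h.deriv
  have hscale : ∀ n (z : ℂ), ‖c n • z‖ ≤ ‖z‖ := fun n z => by
    rw [norm_smul, Real.norm_of_nonneg (hc0 n).le]
    exact mul_le_of_le_one_left (norm_nonneg _) (hc1 n)
  refine ⟨fun n x => β (c n * x), M₀ + M₁ + M₂, by positivity, fun n => ?_, fun n => ?_,
    fun n x => ⟨?_, ?_, ?_⟩, fun x => ?_⟩
  · exact hβ.comp (contDiff_const.mul contDiff_id)
  · exact hβc.comp_homeomorph (Homeomorph.mulLeft₀ (c n) (hc0 n).ne')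
  · exact (hM₀ _).trans (by linarith)
  · rw [hd1]
    exact (hscale _ _).trans ((hM₁ _).trans (by linarith))
  · rw [hd2]
    exact (hscale _ _).trans ((hscale _ _).trans ((hM₂ _).trans (by linarith)))
  · have hlim : Tendsto (fun n => c n * x) atTop (𝓝 0) := by
      have := (tendsto_one_div_add_atTop_nhds_zero_nat (𝕜 := ℝ)).mul_const x
      rwa [zero_mul] at this
    filter_upwards [hlim.eventually (Metric.ball_mem_nhds 0 one_pos)] with n hn
    have h1 := hone _ hn
    have h2 : deriv β =ᶠ[𝓝 (c n * x)] fun _ => 0 :=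
      h1.deriv.trans (Eventually.of_forall fun y => deriv_const y _)
    refine ⟨h1.eq_of_nhds, ?_, ?_⟩
    · rw [hd1]; simp only [h2.eq_of_nhds, smul_zero]
    · rw [hd2]; simp only [h2.deriv_eq, deriv_const, smul_zero]

lemma L2R.tendsto_of_dominated {f : ℕ → L2R} {f₀ : L2R} {bound : ℝ → ℝ} (hb : Integrable bound)
    (hle : ∀ n, ∀ᵐ x, ‖f n x - f₀ x‖ ^ 2 ≤ bound x)
    (hev : ∀ᵐ x, ∀ᶠ n in atTop, f n x = f₀ x) : Tendsto f atTop (𝓝 f₀) := by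
  rw [tendsto_iff_norm_sub_tendsto_zero]
  have h1 : ∀ n, ‖f n - f₀‖ ^ 2 = ∫ x, ‖f n x - f₀ x‖ ^ 2 := fun n => by
    rw [L2R.norm_sq_eq]
    refine integral_congr_ae ?_
    filter_upwards [Lp.coeFn_sub (f n) f₀] with x hx
    rw [hx, Pi.sub_apply]
  have h2 : Tendsto (fun n => ∫ x, ‖f n x - f₀ x‖ ^ 2) atTop (𝓝 (∫ _ : ℝ, (0 : ℝ))) := by
    refine tendsto_integral_of_dominated_convergence bound (fun n => ?_) hb (fun n => ?_) ?_
    · exact (((Lp.aestronglyMeasurable (f n)).sub (Lp.aestronglyMeasurable f₀)).norm.pow 2)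
    · filter_upwards [hle n] with x hx
      rwa [Real.norm_of_nonneg (sq_nonneg _)]
    · filter_upwards [hev] with x hx
      refine tendsto_const_nhds.congr' ?_
      filter_upwards [hx] with n hn
      simp [hn]
  simp only [← h1, integral_zero] at h2
  have := h2.sqrt
  simpa [Real.sqrt_sq] using this

/-- The weak derivative of a function in the operator domain has a weak derivative. -/
lemma hasWeakDeriv_weakDeriv_of_mem_graph {B : ℝ} {v : ℝ → ℝ} (hv : PotentialCondition v) {p : ℝ}
    {w : L2R} (u : formDomain B v)
    (h : ∀ η : formDomain B v, fiberForm B hv p η u = ⟪(η : L2R), w⟫_ℂ) :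
    HasWeakDeriv (formDomain.weakDeriv u)
      (fun x => (((p + B * x) ^ 2 + v x : ℝ) : ℂ) * (u : L2R) x - w x) := by
  intro φ hφ hc
  -- The form is antilinear in its first slot, so inserting the conjugate of `φ` there produces the
  -- bilinear pairing with `φ`.
  have hψ : ContDiff ℝ ∞ (fun x => starRingEnd ℂ (φ x)) := Complex.conjCLE.contDiff.comp hφ
  have hψc : HasCompactSupport (fun x => starRingEnd ℂ (φ x)) :=
    hc.comp_left (g := starRingEnd ℂ) (map_zero _)
  have hm : MemLp (fun x => starRingEnd ℂ (φ x)) 2 volume :=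
    hψ.continuous.memLp_of_hasCompactSupport hψc
  have hd : ∀ x, deriv (fun x => starRingEnd ℂ (φ x)) x = starRingEnd ℂ (deriv φ x) := fun x =>
    ((hφ.differentiable (by simp) x).hasDerivAt.star).deriv
  have hψ1 : ContDiff ℝ 1 (fun x => starRingEnd ℂ (φ x)) := hψ.of_le (by exact_mod_cast le_top)
  have hm' : MemLp (deriv fun x => starRingEnd ℂ (φ x)) 2 volume :=
    (hψ1.continuous_deriv le_rfl).memLp_of_hasCompactSupport hψc.deriv
  set η : formDomain B v := ⟨hm.toLp, mem_formDomain_of_testFunction B hv hψ hψc hm.coeFn_toLp⟩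
  have hη : formDomain.weakDeriv η = hm'.toLp :=
    formDomain.eq_of_hasWeakDeriv (formDomain.hasWeakDeriv η)
      ((hasWeakDeriv_of_contDiff hψ1).congr hm.coeFn_toLp.symm hm'.coeFn_toLp.symm)
  have hηe : (η : L2R) =ᵐ[volume] fun x => starRingEnd ℂ (φ x) := hm.coeFn_toLp
  have h1 := h η
  have i1 := formDomain.integrable_fiberPotential hv (p : ℂ) η u
  have i2 : Integrable (fun x => φ x * w x) :=
    integrable_testFunction_mul hφ.continuous hc (L2R.locallyIntegrable w)
  have e1 : ∫ x, starRingEnd ℂ ((η : L2R) x) * (fiberPotential B v p x * (u : L2R) x) =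
      ∫ x, φ x * ((((p + B * x) ^ 2 + v x : ℝ) : ℂ) * (u : L2R) x) := by
    refine integral_congr_ae ?_
    filter_upwards [hηe] with x hx
    rw [hx, Complex.conj_conj, fiberPotential_ofReal]
  have i1' : Integrable (fun x => φ x * ((((p + B * x) ^ 2 + v x : ℝ) : ℂ) * (u : L2R) x)) := by
    refine i1.congr ?_
    filter_upwards [hηe] with x hx
    rw [hx, Complex.conj_conj, fiberPotential_ofReal]
  have e2 : ⟪(η : L2R), w⟫_ℂ = ∫ x, φ x * w x := by
    rw [L2.inner_def]
    refine integral_congr_ae ?_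
    filter_upwards [hηe] with x hx
    rw [hx, RCLike.inner_apply, Complex.conj_conj, mul_comm]
  have e3 : ⟪formDomain.weakDeriv η, formDomain.weakDeriv u⟫_ℂ =
      ∫ x, deriv φ x * formDomain.weakDeriv u x := by
    rw [hη, L2.inner_def]
    refine integral_congr_ae ?_
    filter_upwards [hm'.coeFn_toLp] with x hx
    rw [hx, RCLike.inner_apply, hd, Complex.conj_conj, mul_comm]
  rw [fiberForm_apply, e1, e2, e3] at h1
  simp only [mul_sub]
  rw [integral_sub i1' i2]
  linear_combination h1

lemma graph_le_closure_fiberMinimalGraph (B : ℝ) {v : ℝ → ℝ} (hv : PotentialCondition v) (p : ℝ) :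
    (fiberForm B hv p).graph ≤ (fiberMinimalGraph B v p).topologicalClosure := by
  rintro ⟨u, w⟩ ⟨hu, h⟩
  set U : formDomain B v := ⟨u, hu⟩
  set g : L2R := formDomain.weakDeriv U
  set k : ℝ → ℂ := fun x => (((p + B * x) ^ 2 + v x : ℝ) : ℂ) * u x - w x
  have hg : HasWeakDeriv u g := formDomain.hasWeakDeriv U
  have hkw : HasWeakDeriv g k := hasWeakDeriv_weakDeriv_of_mem_graph hv U h
  have hWc : ∀ K : Set ℝ, IsCompact K →
      MemLp (fun x => (((p + B * x) ^ 2 + v x : ℝ) : ℂ)) 2 (volume.restrict K) := fun K hK =>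
    (hv.memLp_realPotential B p hK).ofReal
  obtain ⟨c, hc⟩ := hg.exists_ae_eq_integral (L2R.locallyIntegrable u) (L2R.locallyIntegrable g)
  have hk : LocallyIntegrable k := by
    refine LocallyIntegrable.sub ?_ (L2R.locallyIntegrable w)
    rw [locallyIntegrable_iff]
    intro K hK
    exact (hWc K hK).integrable_mul ((Lp.memLp u).restrict K)
  obtain ⟨c', hc'⟩ := hkw.exists_ae_eq_integral (L2R.locallyIntegrable g) hk
  set g₁ : ℝ → ℂ := fun x => c' + ∫ t in (0 : ℝ)..x, k t
  set u₁ : ℝ → ℂ := fun x => c + ∫ t in (0 : ℝ)..x, g₁ t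
  have hu₁ : u =ᵐ[volume] u₁ := by
    refine hc.trans (Eventually.of_forall fun x => ?_)
    simp only [u₁]
    rw [intervalIntegral.integral_congr_ae (hc'.mono fun x hx _ => hx)]
  have hg₁c : Continuous g₁ :=
    continuous_const.add (continuous_integral_of_locallyIntegrable hk 0)
  have hu₁c : Continuous u₁ :=
    continuous_const.add (continuous_integral_of_locallyIntegrable hg₁c.locallyIntegrable 0)
  -- The continuous representative of `u` is locally bounded, which upgrades `k = V u - w` from
  -- locally integrable to `L²_loc`.
  have hk2 : ∀ K : Set ℝ, IsCompact K → MemLp k 2 (volume.restrict K) := by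
    intro K hK
    refine MemLp.sub ?_ ((Lp.memLp w).restrict K)
    obtain ⟨M, hM⟩ := hK.exists_bound_of_continuousOn hu₁c.continuousOn
    refine MemLp.of_le_mul (c := M) (hWc K hK) ((hWc K hK).aestronglyMeasurable.mul
      (Lp.aestronglyMeasurable u).restrict) ?_
    filter_upwards [ae_restrict_of_ae hu₁, ae_restrict_mem hK.measurableSet] with x hx hxK
    rw [norm_mul, mul_comm, hx]
    exact mul_le_mul_of_nonneg_right (hM x hxK) (norm_nonneg _)
  obtain ⟨χ, M, hM, hχ, hχc, hχb, hχ1⟩ := exists_smooth_cutoff_seq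
  have hχ' : ∀ n, ContDiff ℝ ∞ (deriv (χ n)) := fun n => (contDiff_infty_iff_deriv.1 (hχ n)).2
  have hχ'' : ∀ n, ContDiff ℝ ∞ (deriv (deriv (χ n))) := fun n =>
    (contDiff_infty_iff_deriv.1 (hχ' n)).2
  have hmul : ∀ {θ : ℝ → ℂ} (f : L2R), Continuous θ → (∀ x, ‖θ x‖ ≤ M) →
      MemLp (fun x => θ x * f x) 2 volume := by
    intro θ f hθ hb
    refine MemLp.of_le_mul (c := M) (Lp.memLp f) (hθ.aestronglyMeasurable.mul
      (Lp.aestronglyMeasurable f)) (Eventually.of_forall fun x => ?_)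
    rw [norm_mul]
    exact mul_le_mul_of_nonneg_right (hb x) (norm_nonneg _)
  have ha : ∀ n, MemLp (fun x => χ n x * u x) 2 volume := fun n =>
    hmul u (hχ n).continuous fun x => (hχb n x).1
  -- Because `V u - k = w`, the potential drops out of the image of the truncation `χₙ u`; no growth
  -- condition on `V` enters.
  have hb : ∀ n, MemLp (fun x => χ n x * w x - 2 * (deriv (χ n) x * g x)
      - deriv (deriv (χ n)) x * u x) 2 volume := fun n =>
    ((hmul w (hχ n).continuous fun x => (hχb n x).1).sub
      ((hmul g (hχ' n).continuous fun x => (hχb n x).2.1).const_mul 2)).sub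
      (hmul u (hχ'' n).continuous fun x => (hχb n x).2.2)
  have hmem : ∀ n, ((ha n).toLp, (hb n).toLp) ∈ (fiberMinimalGraph B v p).topologicalClosure := by
    intro n
    refine truncation_mem_closure_fiberMinimalGraph hv hk hk2 (g := g₁) (u := u₁) (c := c)
      (c' := c') (fun _ => rfl) (fun _ => rfl) (hχ n) (hχc n) ?_ ?_
    · filter_upwards [(ha n).coeFn_toLp, hu₁] with x h1 h2
      rw [h1, h2]
    · filter_upwards [(hb n).coeFn_toLp, hu₁, hc'] with x h1 h2 h3
      rw [h1, ← h2, ← h3]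
      simp only [k]
      ring
  have hsq : ∀ f : L2R, Integrable fun x => ‖f x‖ ^ 2 := L2R.integrable_norm_sq
  have lim1 : Tendsto (fun n => (ha n).toLp) atTop (𝓝 u) := by
    refine L2R.tendsto_of_dominated ((hsq u).const_mul ((M + 1) ^ 2)) (fun n => ?_) ?_
    · filter_upwards [(ha n).coeFn_toLp] with x h1
      rw [h1, show χ n x * u x - u x = (χ n x - 1) * u x by ring, norm_mul, mul_pow]
      gcongr
      exact (norm_sub_le _ _).trans (by rw [norm_one]; linarith [(hχb n x).1])
    · filter_upwards [ae_all_iff.2 fun n => (ha n).coeFn_toLp] with x h1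
      filter_upwards [hχ1 x] with n hn
      rw [h1, hn.1, one_mul]
  -- The commutator terms vanish by dominated convergence: `χₙ'` and `χₙ''` are uniformly bounded
  -- and eventually zero at each point, while `u'` and `u` are in `L²`.
  have lim2 : Tendsto (fun n => (hb n).toLp) atTop (𝓝 w) := by
    refine L2R.tendsto_of_dominated ((((hsq w).const_mul (3 * (M + 1) ^ 2)).add
      ((hsq g).const_mul (12 * M ^ 2))).add ((hsq u).const_mul (3 * M ^ 2))) (fun n => ?_) ?_
    · filter_upwards [(hb n).coeFn_toLp] with x h1
      have e : χ n x * w x - 2 * (deriv (χ n) x * g x) - deriv (deriv (χ n)) x * u x - w x =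
          (χ n x - 1) * w x - 2 * (deriv (χ n) x * g x) - deriv (deriv (χ n)) x * u x := by ring
      rw [h1, e]
      obtain ⟨m0, m1, m2⟩ := hχb n x
      have b0 : ‖(χ n x - 1) * w x‖ ≤ (M + 1) * ‖w x‖ := by
        rw [norm_mul]
        gcongr
        exact (norm_sub_le _ _).trans (by rw [norm_one]; linarith)
      have b1 : ‖2 * (deriv (χ n) x * g x)‖ ≤ 2 * (M * ‖g x‖) := by
        rw [norm_mul, norm_mul, Complex.norm_ofNat]
        gcongr
      have b2 : ‖deriv (deriv (χ n)) x * u x‖ ≤ M * ‖u x‖ := by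
        rw [norm_mul]
        gcongr
      have b3 : ‖(χ n x - 1) * w x - 2 * (deriv (χ n) x * g x) - deriv (deriv (χ n)) x * u x‖ ≤
          (M + 1) * ‖w x‖ + 2 * (M * ‖g x‖) + M * ‖u x‖ :=
        (norm_sub_le _ _).trans (add_le_add ((norm_sub_le _ _).trans (add_le_add b0 b1)) b2)
      refine (pow_le_pow_left₀ (norm_nonneg _) b3 2).trans ?_
      simp only [Pi.add_apply]
      nlinarith [sq_nonneg ((M + 1) * ‖w x‖ - 2 * (M * ‖g x‖)),
        sq_nonneg ((M + 1) * ‖w x‖ - M * ‖u x‖), sq_nonneg (2 * (M * ‖g x‖) - M * ‖u x‖)]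
    · filter_upwards [ae_all_iff.2 fun n => (hb n).coeFn_toLp] with x h1
      filter_upwards [hχ1 x] with n hn
      rw [h1, hn.1, hn.2.1, hn.2.2]
      ring
  exact (Submodule.isClosed_topologicalClosure _).mem_of_tendsto (lim1.prodMk_nhds lim2)
    (Eventually.of_forall hmem)

/-- The fiber operator is the operator associated with the fiber form. -/
lemma operator_fiberForm (B : ℝ) {v : ℝ → ℝ} (hv : PotentialCondition v) (p : ℝ) :
    (fiberForm B hv p).operator = fiberOperator B v p := by
  have hD := dense_formDomain B hv
  have hle := fiberMinimalGraph_le_graph B hv p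
  have hgr : (fiberMinimalGraph B v p).toLinearPMap.graph = fiberMinimalGraph B v p :=
    Submodule.toLinearPMap_graph_eq _ fun a ha h0 =>
      SesqForm.graph_snd_eq_zero _ hD a (hle ha) h0
  have hcl : (fiberMinimalGraph B v p).topologicalClosure = (fiberForm B hv p).graph :=
    le_antisymm (Submodule.topologicalClosure_minimal _ hle (isClosed_graph_fiberForm B hv p))
      (graph_le_closure_fiberMinimalGraph B hv p)
  -- The closure of the minimal graph is already the graph of an operator, namely the form operator.
  have hclosable : (fiberMinimalGraph B v p).toLinearPMap.IsClosable :=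
    ⟨(fiberForm B hv p).operator, by rw [hgr, hcl, SesqForm.graph_operator _ hD]⟩
  refine LinearPMap.eq_of_eq_graph ?_
  rw [SesqForm.graph_operator _ hD, fiberOperator, ← hclosable.graph_closure_eq_closure_graph, hgr,
    hcl]

/-- The fiber operators form an analytic family of type (B); moreover the forms `q p` of the
operators `h_v(p)` have a common domain `D`, differ by `d_p`, and `d_p` is relatively bounded with
respect to `q p₀` with arbitrarily small relative bound, locally uniformly in `p`. -/
theorem proposition2p2 (B : ℝ) (v : ℝ → ℝ) (hv : PotentialCondition v) :
    IsAnalyticFamilyTypeB (fiberOperator B v) ∧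
    ∃ (D : Submodule ℂ L2R) (q : ℝ → SesqForm D),
      Dense (D : Set L2R) ∧
      (∀ p : ℝ, (q p).IsSectorial ∧ (q p).IsClosedForm ∧
        (q p).IsAssociated (fiberOperator B v p)) ∧
      (∀ (p₀ p : ℝ) (ψ : D),
        Integrable (fun x => 2 * B * x * (p - p₀) * ‖(ψ : L2R) x‖ ^ 2) volume ∧
        q p ψ ψ = q p₀ ψ ψ + ((formPerturbation B p₀ p (ψ : L2R) : ℝ) : ℂ)) ∧
      ∀ p₀ R ε : ℝ, 0 < ε → ∃ δ : ℝ, ∀ p : ℝ, |p - p₀| ≤ R → ∀ ψ : D,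
        |formPerturbation B p₀ p (ψ : L2R)| ≤
          ε * (q p₀ ψ ψ).re + δ * ‖(ψ : L2R)‖ ^ 2 := by
  have hassoc : ∀ p : ℝ, (fiberForm B hv p).IsAssociated (fiberOperator B v p) := fun p => by
    rw [← operator_fiberForm B hv p]
    exact SesqForm.isAssociated_operator _ (dense_formDomain B hv)
  -- The bounds hold for every complex `κ`, so `Ω` is all of `ℂ`; agreement with the fiber operators
  -- is needed only at real `κ`.
  refine ⟨⟨Set.univ, fun κ => (fiberForm B hv κ).operator, fun _ => Set.mem_univ _,
    ⟨formDomain B v, fiberForm B hv, ⟨isOpen_univ, isConnected_univ, dense_formDomain B hv,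
      fun κ _ => fiberForm_isSectorial B hv κ, fun κ _ => fiberForm_isClosedForm B hv κ,
      fun u => (differentiable_fiberForm_self B hv u).differentiableOn⟩,
      fun κ _ => SesqForm.isAssociated_operator _ (dense_formDomain B hv)⟩,
    operator_fiberForm B hv⟩, formDomain B v, fun p => fiberForm B hv p, dense_formDomain B hv,
    fun p => ⟨fiberForm_isSectorial B hv p, fiberForm_isClosedForm B hv p, hassoc p⟩,
    fun p₀ p ψ => ⟨integrable_formPerturbation p₀ p ψ,
      fiberForm_eq_add_formPerturbation B hv p₀ p ψ⟩,
    exists_formPerturbation_bound B hv⟩
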